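/- Let $X$ be a complex Banach space, let $A, V$ be bounded linear operators on $X$, and put $A(t) := A + tV$ for $t \in \mathbb{C}$. Let $\Gamma$ be a positively oriented rectifiable simple closed curve in $\mathbb{C}$ contained in the resolvent set $\rho(A)$, with enclosed open region $\mathrm{Int}(\Gamma)$. Write $R(z) := (A - zI)^{-1}$ and $R(t,z) := (A(t) - zI)^{-1}$ for the resolvents, $r_\sigma$ for the spectral radius, $\mathrm{Tr}$ for the trace of a finite rank operator, and $$P := \frac{-1}{2\pi i}\int_\Gamma R(z)\,dz,\qquad P(t) := \frac{-1}{2\pi i}\int_\Gamma R(t,z)\,dz,\qquad \widehat P_n := \frac{(-1)^{n+1}}{2\pi i}\int_\Gamma R(z)\,[V R(z)]^n\,dz,$$ $$\partial_\Gamma := \Big\{ t \in \mathbb{C} : |t| \max_{z\in\Gamma} r_\sigma(V R(z)) < 1 \Big\}.$$ A discrete eigenvalue of a bounded operator $B$ is an isolated point $\mu$ of its spectrum $\sigma(B)$ whose spectral projection $\frac{-1}{2\pi i}\int_{|z-\mu| = r} (B - zI)^{-1}dz$ ($r>0$ small) has finite rank; this rank is the algebraic multiplicity of $\mu$, and $\mu$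 is simple if the multiplicity is $1$. **Theorem.** Suppose that $\sigma(A)\cap \mathrm{Int}(\Gamma)$ consists of discrete eigenvalues of $A$ and that $\mathrm{rank}(P) = m$ with $1 \le m < \infty$. Then: 1. For every $t \in \partial_\Gamma$ we have $\Gamma \subset \rho(A(t))$, $\mathrm{rank}(P(t)) = m$, and $\sigma(A(t)) \cap \mathrm{Int}(\Gamma)$ is a finite set of discrete eigenvalues of $A(t)$ with exactly $m$ members $\lambda_1(t), \ldots, \lambda_m(t)$ counted with algebraic multiplicity. 2. Let $\lambda_{\mathrm{av}}(t) := \frac{1}{m}(\lambda_1(t) + \cdots + \lambda_m(t))$ for $t \in \partial_\Gamma$, and let $\lambda_{\mathrm{av}}$ be the arithmetic mean of the eigenvalues of $A$ inside $\Gamma$, counted with multiplicity. Then $\lambda_{\mathrm{av}}(t)$ is analytic in $\partial_\Gamma$. For every $t \in \partial_\Gamma$ the series $P(t) = P + \sum_{n=1}^\infty \widehat P_n t^n$ converges in operator norm and $$\lambda_{\mathrm{av}}(t) = \frac{\mathrm{Tr}(A(t)P(t))}{m} = \frac1m \mathrm{Tr}\Big( (A+tV)\Big(P + \sum_{n=1}^\infty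 \widehat P_n t^n\Big)\Big).$$ There are $\alpha_1, \alpha_2, \ldots \in \mathbb{C}$, independent of $t$, such that $\lambda_{\mathrm{av}}(t) = \lambda_{\mathrm{av}} + \sum_{n=1}^\infty \alpha_n t^n$ for all $t \in \partial_\Gamma$. 3. If $m = 1$, then $\lambda_{\mathrm{av}}(0) = \lambda_{\mathrm{av}}$ and, for every $t \in \partial_\Gamma$, $\lambda_{\mathrm{av}}(t)$ is a simple eigenvalue of $A(t)$. Moreover, if $v\in X$ and $Av = \lambda_{\mathrm{av}} v$, then $A(t)P(t)v = \lambda_{\mathrm{av}}(t) P(t)v$ for all $t \in \partial_\Gamma$, the map $t \mapsto P(t)v$ is analytic in $\partial_\Gamma$, and there are $\widehat v_1, \widehat v_2, \ldots \in X$, independent of $t$, such that $P(t)v = v + \sum_{n=1}^\infty \widehat v_n t^n$ for all $t \in \partial_\Gamma$. -/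

import Mathlib

open Set

noncomputable section

namespace SpectralPerturbation

/-! ### Rectifiable simple closed curves -/

/-- `γ`, restricted to `[0, 1]`, is a rectifiable simple closed curve in the plane. -/
structure IsRectifiableSimpleClosed (γ : ℝ → ℂ) : Prop where
  continuousOn : ContinuousOn γ (Icc 0 1)
  rectifiable : BoundedVariationOn γ (Icc 0 1)
  closed : γ 0 = γ 1
  simple : InjOn γ (Ico 0 1)

/-- The point set of the curve. -/
def trace (γ : ℝ → ℂ) : Set ℂ := γ '' Icc 0 1

/-- The open region enclosed by the curve: the points off the curve whose connected component in
the complement of the curve is bounded. -/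
def interior (γ : ℝ → ℂ) : Set ℂ :=
  {z | z ∈ (trace γ)ᶜ ∧ Bornology.IsBounded (connectedComponentIn (trace γ)ᶜ z)}

/-- The length of the curve. -/
def length (γ : ℝ → ℂ) : ℝ := variationOnFromTo γ (Icc 0 1) 0 1

/-- The contour integral `∫_γ f(z) dz` along a rectifiable curve, computed in the arc length
parametrization of the curve. -/
def contourIntegral {E : Type*} [NormedAddCommGroup E] [NormedSpace ℂ E]
    (γ : ℝ → ℂ) (f : ℂ → E) : E :=
  ∫ s in (0 : ℝ)..length γ,
    deriv (naturalParameterization γ (Icc 0 1) 0) s •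
      f (naturalParameterization γ (Icc 0 1) 0 s)

/-- The curve winds exactly once, counterclockwise, around each point that it encloses. -/
def IsPositivelyOriented (γ : ℝ → ℂ) : Prop :=
  ∀ z ∈ interior γ, contourIntegral γ (fun w => (w - z)⁻¹) = 2 * Real.pi * Complex.I

/-! ### Resolvents, spectral projections, discrete eigenvalues -/

variable {X : Type*} [NormedAddCommGroup X] [NormedSpace ℂ X]

/-- The resolvent `R(z) = (A - z I)⁻¹`. -/
def res (A : X →L[ℂ] X) (z : ℂ) : X →L[ℂ] X := Ring.inverse (A - z • (1 : X →L[ℂ] X))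

/-- `P = (-1 / 2πi) ∫_γ R(z) dz`, the spectral projection of `A` for the part of the spectrum
enclosed by the curve. -/
def proj (γ : ℝ → ℂ) (A : X →L[ℂ] X) : X →L[ℂ] X :=
  (-1 / (2 * Real.pi * Complex.I) : ℂ) • contourIntegral γ (res A)

/-- The coefficients `((-1)^(n+1) / 2πi) ∫_γ R(z) (V R(z))^n dz` of the Kato-Rellich series. -/
def projCoeff (γ : ℝ → ℂ) (A V : X →L[ℂ] X) (n : ℕ) : X →L[ℂ] X :=
  ((-1) ^ (n + 1) / (2 * Real.pi * Complex.I) : ℂ) •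
    contourIntegral γ (fun z => res A z * (V * res A z) ^ n)

/-- `μ` is an isolated point of the spectrum of `A`, in the form that some closed disc around `μ`
contains no other spectral value. -/
def IsIsolatedSpectral (A : X →L[ℂ] X) (μ : ℂ) : Prop :=
  ∃ r : ℝ, 0 < r ∧ spectrum ℂ A ∩ Metric.closedBall μ r = {μ}

open Classical in
/-- The spectral projection of `A` associated with an isolated point `μ` of the spectrum: the
contour integral over a circle around `μ` that isolates `μ` from the rest of the spectrum (it does
not depend on the circle). The value is `0` if `μ` is not an isolated point of the spectrum. -/
def spectralProjAt (A : X →L[ℂ] X) (μ : ℂ) : X →L[ℂ] X :=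
  if h : IsIsolatedSpectral A μ then
    (-1 / (2 * Real.pi * Complex.I) : ℂ) • ∮ z in C(μ, h.choose), res A z
  else 0

/-- Discrete eigenvalues: isolated spectral points whose spectral projection has finite rank. -/
def IsDiscreteEigenvalue (A : X →L[ℂ] X) (μ : ℂ) : Prop :=
  IsIsolatedSpectral A μ ∧ FiniteDimensional ℂ (LinearMap.range (spectralProjAt A μ).toLinearMap)

/-- The algebraic multiplicity of a discrete eigenvalue: the rank of its spectral projection. -/
def algMult (A : X →L[ℂ] X) (μ : ℂ) : ℕ :=
  Module.finrank ℂ (LinearMap.range (spectralProjAt A μ).toLinearMap)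

/-- A simple eigenvalue: a discrete eigenvalue of algebraic multiplicity one. -/
def IsSimpleEigenvalue (A : X →L[ℂ] X) (μ : ℂ) : Prop :=
  Module.End.HasEigenvalue A.toLinearMap μ ∧ IsDiscreteEigenvalue A μ ∧ algMult A μ = 1

/-- The spectral values of `A` in `U`, each listed as often as its algebraic multiplicity (for
finitely many discrete eigenvalues in `U`). -/
def eigenvaluesIn (A : X →L[ℂ] X) (U : Set ℂ) : Multiset ℂ :=
  ∑ᶠ μ ∈ spectrum ℂ A ∩ U, Multiset.replicate (algMult A μ) μ

/-- The arithmetic mean of the eigenvalues of `A` in `U`, counted with multiplicity. -/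
def eigMean (A : X →L[ℂ] X) (U : Set ℂ) : ℂ :=
  (eigenvaluesIn A U).sum / (Multiset.card (eigenvaluesIn A U) : ℂ)

/-- The trace of a finite rank operator `T`: the trace of the endomorphism that `T` induces on its
(finite-dimensional) range. -/
def finRankTrace (T : X →L[ℂ] X) : ℂ :=
  LinearMap.trace ℂ (LinearMap.range T.toLinearMap)
    (T.toLinearMap.rangeRestrict ∘ₗ (LinearMap.range T.toLinearMap).subtype)

/-- The disc `{t : |t| max_{z ∈ Γ} r_σ(V R(z)) < 1}`. -/
def pertDisc (γ : ℝ → ℂ) (A V : X →L[ℂ] X) : Set ℂ :=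
  {t | ‖t‖ₑ * (⨆ z ∈ trace γ, spectralRadius ℂ (V * res A z)) < 1}

end SpectralPerturbation

end

/-!
The Riesz projection `P = (-1 / 2πi) ∫_Γ (B - z)⁻¹ dz` is analysed without functional calculus and
without deforming the curve. Say that an operator `Q` is divisible by `B - z` on `U` (`DivisibleOn`)
if `Q = (B - z) T(z)` for a holomorphic family `T` on `U` that commutes with `B`. Every operator
that commutes with `B` is divisible on the resolvent set, quotients of products can be glued
(`DivisibleOn.mul`), and by Liouville's theorem only `0` is divisible on the whole plane
(`DivisibleOn.eq_zero`). Integrating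
`(B - z) (B - w)⁻¹ (w - z)⁻¹ = (w - z)⁻¹ + (B - w)⁻¹` over `w ∈ Γ` shows that `P` is divisible on
the exterior of `Γ` and `1 - P` on the interior (`Encloses.riesz_divisibleOn`,
`Encloses.one_sub_riesz_divisibleOn`). Hence `P (1 - P)` is divisible everywhere, so `P² = P`. In the
same way the spectral projections `P_μ` at the points `μ` of the spectrum inside `Γ` annihilate each
other and add up to `P` (`IsSpectralProj.eq_sum_spectralProjAt`). If `P` has finite rank, these
points are among the eigenvalues of `B` on the range of `P`, and taking traces of `P = ∑ P_μ` and
`B P = ∑ B P_μ` gives the count of the eigenvalues and their mean `Tr(B P) / rank P`.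

The only facts about the curve that this needs are that it winds once around the points it encloses,
which is the hypothesis of positive orientation, and not at all around the others. The latter holds
because the winding integral is locally constant and vanishes at infinity, the exterior being
connected to infinity (`IsRectifiableSimpleClosed.winding_exterior`). No form of the Jordan curve
theorem enters.

For the dependence on `t`: the set `pertDisc` is an open disc around `0` on which `P(t)` is
holomorphic by differentiation under the integral sign. Its derivatives are given by
`d/dt [R (V R)ⁿ] = -(n + 1) R (V R)ⁿ⁺¹`, which identifies the Taylor coefficients at `0` with
`projCoeff`, and a Taylor series converges in the whole disc of holomorphy. Kato's operators
`katoTransform` conjugate `P(t)` to `P(t₀)` for `t` near `t₀`; therefore the rank is constant and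
`Tr((A + tV) P(t))` is holomorphic. A simple eigenvalue is the case of rank one, where `A + tV` acts
on the range of `P(t)` as a scalar.
-/

namespace SpectralPerturbation

open MeasureTheory Filter Topology

/-! ### Integrals along closed Lipschitz curves -/

/-- The integral of `f` along the Lipschitz curve `c : [a, b] → ℂ`. Both `contourIntegral` (with
the arc length parametrization) and `circleIntegral` unfold to it. -/
noncomputable def lineIntegral {E : Type*} [NormedAddCommGroup E] [NormedSpace ℂ E]
    (c : ℝ → ℂ) (a b : ℝ) (f : ℂ → E) : E :=
  ∫ s in a..b, deriv c s • f (c s)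

/-- `c` is a closed Lipschitz curve on `[a, b]`. -/
structure IsLipschitzLoop (c : ℝ → ℂ) (a b : ℝ) : Prop where
  le : a ≤ b
  lipschitz : ∃ K, LipschitzOnWith K c (Icc a b)
  closed : c a = c b

namespace IsLipschitzLoop

variable {E F : Type*} [NormedAddCommGroup E] [NormedSpace ℂ E]
  [NormedAddCommGroup F] [NormedSpace ℂ F] {c : ℝ → ℂ} {a b : ℝ}

theorem continuousOn (h : IsLipschitzLoop c a b) : ContinuousOn c (Icc a b) :=
  h.lipschitz.choose_spec.continuousOn

theorem isCompact_image (h : IsLipschitzLoop c a b) : IsCompact (c '' Icc a b) :=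
  isCompact_Icc.image_of_continuousOn h.continuousOn

theorem norm_deriv_le {K : NNReal} (h : LipschitzOnWith K c (Icc a b)) {s : ℝ}
    (hs : s ∈ Ioo a b) : ‖deriv c s‖ ≤ K :=
  norm_deriv_le_of_lipschitzOn (Icc_mem_nhds hs.1 hs.2) h

theorem ae_mem_Ioo : ∀ᵐ s : ℝ, s ∈ uIoc a b → a ≤ b → s ∈ Ioo a b := by
  filter_upwards [(measure_eq_zero_iff_ae_notMem (μ := volume)).1 (measure_singleton b)]
    with s hs hs' hab
  rw [uIoc_of_le hab] at hs'
  exact ⟨hs'.1, lt_of_le_of_ne hs'.2 hs⟩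

omit [NormedSpace ℂ E] in
theorem comp_continuousOn (h : IsLipschitzLoop c a b) {f : ℂ → E}
    (hf : ContinuousOn f (c '' Icc a b)) : ContinuousOn (fun s => f (c s)) (Icc a b) :=
  hf.comp h.continuousOn (mapsTo_image _ _)

theorem intervalIntegrable_deriv (h : IsLipschitzLoop c a b) :
    IntervalIntegrable (deriv c) volume a b := by
  obtain ⟨K, hK⟩ := h.lipschitz
  refine (intervalIntegrable_const (c := (K : ℝ))).mono_fun
    (measurable_deriv c).aestronglyMeasurable ?_
  rw [EventuallyLE, ae_restrict_iff' measurableSet_uIoc]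
  filter_upwards [ae_mem_Ioo (a := a) (b := b)] with s hs hs'
  simpa using norm_deriv_le hK (hs hs' h.le)

theorem intervalIntegrable (h : IsLipschitzLoop c a b) {f : ℂ → E}
    (hf : ContinuousOn f (c '' Icc a b)) :
    IntervalIntegrable (fun s => deriv c s • f (c s)) volume a b :=
  h.intervalIntegrable_deriv.smul_continuousOn
    (by rw [uIcc_of_le h.le]; exact h.comp_continuousOn hf)

theorem lineIntegral_congr (h : IsLipschitzLoop c a b) {f g : ℂ → E}
    (hfg : ∀ w ∈ c '' Icc a b, f w = g w) : lineIntegral c a b f = lineIntegral c a b g := by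
  refine intervalIntegral.integral_congr fun s hs => ?_
  rw [uIcc_of_le h.le] at hs
  simp only [hfg _ (mem_image_of_mem c hs)]

theorem lineIntegral_add (h : IsLipschitzLoop c a b) {f g : ℂ → E}
    (hf : ContinuousOn f (c '' Icc a b)) (hg : ContinuousOn g (c '' Icc a b)) :
    lineIntegral c a b (fun w => f w + g w) = lineIntegral c a b f + lineIntegral c a b g := by
  simp only [lineIntegral, smul_add]
  exact intervalIntegral.integral_add (h.intervalIntegrable hf) (h.intervalIntegrable hg)

theorem lineIntegral_clm (h : IsLipschitzLoop c a b) [CompleteSpace E] [CompleteSpace F]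
    (L : E →L[ℂ] F) {f : ℂ → E} (hf : ContinuousOn f (c '' Icc a b)) :
    lineIntegral c a b (fun w => L (f w)) = L (lineIntegral c a b f) := by
  have := L.intervalIntegral_comp_comm (h.intervalIntegrable hf)
  simpa [lineIntegral] using this

/-- Differentiation of a line integral with respect to a parameter. -/
theorem hasDerivAt_lineIntegral (h : IsLipschitzLoop c a b) {f f' : ℂ → ℂ → E} {U : Set ℂ}
    (hU : IsOpen U) (hf : ∀ t ∈ U, ContinuousOn (f t) (c '' Icc a b))
    (hf' : ContinuousOn (fun p : ℂ × ℂ => f' p.1 p.2) (U ×ˢ (c '' Icc a b)))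
    (hd : ∀ t ∈ U, ∀ w ∈ c '' Icc a b, HasDerivAt (fun t => f t w) (f' t w) t)
    {t₀ : ℂ} (ht₀ : t₀ ∈ U) :
    HasDerivAt (fun t => lineIntegral c a b (f t)) (lineIntegral c a b (f' t₀)) t₀ := by
  obtain ⟨K, hK⟩ := h.lipschitz
  obtain ⟨r, hr, hrU⟩ := Metric.nhds_basis_closedBall.mem_iff.1 (hU.mem_nhds ht₀)
  obtain ⟨M, hM⟩ := ((isCompact_closedBall t₀ r).prod h.isCompact_image).exists_bound_of_continuousOn
    (hf'.mono (prod_mono_left hrU))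
  have hmeas : ∀ g : ℂ → E, ContinuousOn g (c '' Icc a b) →
      AEStronglyMeasurable (fun s => deriv c s • g (c s)) (volume.restrict (uIoc a b)) :=
    fun g hg => (h.intervalIntegrable hg).def'.aestronglyMeasurable
  have hIcc : ∀ s ∈ uIoc a b, s ∈ Icc a b := fun s hs => by
    rw [uIoc_of_le h.le] at hs; exact Ioc_subset_Icc_self hs
  refine (intervalIntegral.hasDerivAt_integral_of_dominated_loc_of_deriv_le
    (F := fun t s => deriv c s • f t (c s)) (F' := fun t s => deriv c s • f' t (c s))
    (bound := fun _ => K * M) (Metric.closedBall_mem_nhds t₀ hr) ?_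
    (h.intervalIntegrable (hf t₀ ht₀)) ?_ ?_ intervalIntegrable_const ?_).2
  · filter_upwards [hU.mem_nhds ht₀] with t ht using hmeas _ (hf t ht)
  · have hp : ContinuousOn (fun w : ℂ => (t₀, w)) (c '' Icc a b) := by fun_prop
    exact hmeas _ (hf'.comp hp fun w hw => ⟨ht₀, hw⟩)
  · filter_upwards [ae_mem_Ioo (a := a) (b := b)] with s hs hs' t ht
    rw [norm_smul]
    have h1 := norm_deriv_le hK (hs hs' h.le)
    have h2 := hM (t, c s) ⟨ht, mem_image_of_mem c (hIcc s hs')⟩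
    gcongr
  · filter_upwards with s hs t ht
    exact (hd t (hrU ht) _ (mem_image_of_mem c (hIcc s hs))).const_smul _

/-- The fundamental theorem of calculus along a closed Lipschitz curve. -/
theorem lineIntegral_eq_zero_of_hasDerivAt (h : IsLipschitzLoop c a b) {g g' : ℂ → ℂ}
    (hlip : ∃ K, LipschitzOnWith K g (c '' Icc a b))
    (hg : ∀ w ∈ c '' Icc a b, HasDerivAt g (g' w) w) (hg' : ContinuousOn g' (c '' Icc a b)) :
    lineIntegral c a b g' = 0 := by
  obtain ⟨K, hK⟩ := h.lipschitz
  obtain ⟨K', hK'⟩ := hlip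
  have hgc : LipschitzOnWith (K' * K) (g ∘ c) (Icc a b) := hK'.comp hK (mapsTo_image _ _)
  have hae : ∀ᵐ s : ℝ, s ∈ uIoc a b → HasDerivAt (g ∘ c) (deriv c s * g' (c s)) s := by
    filter_upwards [hK.ae_differentiableWithinAt_of_mem, ae_mem_Ioo (a := a) (b := b)]
      with s hs hs' hs''
    have hI := hs' hs'' h.le
    have hd := ((hs (Ioo_subset_Icc_self hI)).differentiableAt (Icc_mem_nhds hI.1 hI.2)).hasDerivAt
    have := (hg (c s) (mem_image_of_mem c (Ioo_subset_Icc_self hI))).scomp s hd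
    simpa using this
  -- the fundamental theorem for absolutely continuous real functions, applied to `re` and `im`
  have key : ∀ L : ℂ →L[ℝ] ℝ, L (lineIntegral c a b g') = 0 := by
    intro L
    have hL : LipschitzOnWith (‖L‖₊ * (K' * K)) (L ∘ (g ∘ c)) (uIcc a b) := by
      rw [uIcc_of_le h.le]
      exact (L.lipschitz.lipschitzOnWith (s := univ)).comp hgc (mapsTo_univ _ _)
    have h1 := hL.absolutelyContinuousOnInterval.integral_deriv_eq_sub
    have h2 : ∫ s in a..b, deriv (L ∘ (g ∘ c)) s = ∫ s in a..b, L (deriv c s • g' (c s)) := by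
      refine intervalIntegral.integral_congr_ae ?_
      filter_upwards [hae] with s hs hs'
      exact (L.hasFDerivAt.comp_hasDerivAt s (hs hs')).deriv
    rw [h2, L.intervalIntegral_comp_comm (h.intervalIntegrable hg')] at h1
    rw [lineIntegral, h1]
    simp [h.closed]
  exact Complex.ext (key Complex.reCLM) (key Complex.imCLM)

/-- The winding integral around `z` has derivative `0` with respect to `z`. -/
theorem hasDerivAt_winding (h : IsLipschitzLoop c a b) {z : ℂ} (hz : z ∉ c '' Icc a b) :
    HasDerivAt (fun z => lineIntegral c a b fun w => (w - z)⁻¹) 0 z := by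
  have hne : ∀ z ∈ (c '' Icc a b)ᶜ, ∀ w ∈ c '' Icc a b, w - z ≠ 0 := fun z hz w hw h0 =>
    hz (sub_eq_zero.1 h0 ▸ hw)
  have h1 := h.hasDerivAt_lineIntegral (f := fun z w => (w - z)⁻¹)
    (f' := fun z w => ((w - z) ^ 2)⁻¹) h.isCompact_image.isClosed.isOpen_compl
    (fun z hz => ContinuousOn.inv₀ (by fun_prop) (hne z hz))
    (ContinuousOn.inv₀ (by fun_prop) (fun p hp => pow_ne_zero 2 (hne _ hp.1 _ hp.2)))
    (fun z hz w hw => by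
      have := ((hasDerivAt_id z).const_sub w).fun_inv (hne z hz w hw)
      simpa [div_eq_mul_inv] using this) hz
  have h2 : lineIntegral c a b (fun w => ((w - z) ^ 2)⁻¹) = 0 := by
    have hc2 : ContinuousOn (fun w => ((w - z) ^ 2)⁻¹) (c '' Icc a b) :=
      ContinuousOn.inv₀ (by fun_prop) (fun w hw => pow_ne_zero 2 (hne z hz _ hw))
    obtain ⟨M, hM⟩ := h.isCompact_image.exists_bound_of_continuousOn
      (f := fun w => (w - z)⁻¹) (ContinuousOn.inv₀ (by fun_prop) (hne z hz))
    refine h.lineIntegral_eq_zero_of_hasDerivAt (g := fun w => -(w - z)⁻¹)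
      ⟨(Real.toNNReal M) ^ 2, LipschitzOnWith.of_dist_le_mul fun w hw w' hw' => ?_⟩ ?_ hc2
    · have e : -(w - z)⁻¹ - -(w' - z)⁻¹ = (w - z)⁻¹ * (w' - z)⁻¹ * (w - w') := by
        have := hne z hz w hw
        have := hne z hz w' hw'
        field_simp
        ring
      have hM1 := hM w hw
      have hM0 : 0 ≤ M := (norm_nonneg _).trans hM1
      have hM2 := hM w' hw'
      rw [dist_eq_norm, dist_eq_norm, e, norm_mul, norm_mul]
      rw [NNReal.coe_pow, Real.coe_toNNReal M hM0, pow_two]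
      gcongr
    · intro w hw
      have := (((hasDerivAt_id w).sub_const z).fun_inv (hne z hz w hw)).fun_neg
      simpa [div_eq_mul_inv] using this
  rwa [h2] at h1

end IsLipschitzLoop

/-! ### The arc length parametrization of a rectifiable curve -/

/-- The variation of a continuous function of bounded variation is continuous. -/
theorem continuousOn_variationOnFromTo {f : ℝ → ℂ} {a b : ℝ} (hab : a ≤ b)
    (hf : ContinuousOn f (Icc a b)) (hbv : BoundedVariationOn f (Icc a b)) :
    ContinuousOn (variationOnFromTo f (Icc a b) a) (Icc a b) := by
  intro x hx
  have hl := hbv.locallyBoundedVariationOn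
  have ha : a ∈ Icc a b := left_mem_Icc.2 hab
  have h1 := ((ENNReal.tendsto_toReal ENNReal.zero_ne_top).comp
    (hbv.tendsto_eVariationOn_Icc_zero_left ((hf x hx).mono inter_subset_left)))
  have h2 := ((ENNReal.tendsto_toReal ENNReal.zero_ne_top).comp
    (hbv.tendsto_eVariationOn_Icc_zero_right x ((hf x hx).mono inter_subset_left)))
  have h3 := h2.sub h1
  simp only [ENNReal.toReal_zero, sub_zero, Function.comp_def] at h3
  -- one of the two variations vanishes, depending on the side of `x` on which `y` lies
  have h4 : Tendsto (variationOnFromTo f (Icc a b) x) (𝓝[Icc a b] x) (𝓝 0) := by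
    refine h3.congr fun y => ?_
    rcases le_total x y with h | h
    · rw [variationOnFromTo.eq_of_le _ _ h, eVariationOn.subsingleton f (s := Icc a b ∩ Icc y x)]
      · simp
      · exact fun u hu v hv => by linarith [hu.2.1, hu.2.2, hv.2.1, hv.2.2]
    · rw [variationOnFromTo.eq_of_ge _ _ h, eVariationOn.subsingleton f (s := Icc a b ∩ Icc x y)]
      · simp
      · exact fun u hu v hv => by linarith [hu.2.1, hu.2.2, hv.2.1, hv.2.2]
  have h5 := h4.const_add (variationOnFromTo f (Icc a b) a x)
  rw [add_zero] at h5
  refine h5.congr' ?_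
  filter_upwards [self_mem_nhdsWithin] with y hy
  exact variationOnFromTo.add hl ha hx hy

section

variable {γ : ℝ → ℂ}

theorem IsRectifiableSimpleClosed.image_variation (hγ : IsRectifiableSimpleClosed γ) :
    variationOnFromTo γ (Icc 0 1) 0 '' Icc 0 1 = Icc 0 (length γ) := by
  have h0 : (0 : ℝ) ∈ Icc (0 : ℝ) 1 := by simp
  have h1 : (1 : ℝ) ∈ Icc (0 : ℝ) 1 := by simp
  have hm := variationOnFromTo.monotoneOn hγ.rectifiable.locallyBoundedVariationOn h0
  apply Subset.antisymm
  · rintro _ ⟨s, hs, rfl⟩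
    exact ⟨variationOnFromTo.nonneg_of_le _ _ hs.1, hm hs h1 hs.2⟩
  · have := intermediate_value_Icc zero_le_one
      (continuousOn_variationOnFromTo zero_le_one hγ.continuousOn hγ.rectifiable)
    rwa [variationOnFromTo.self] at this

theorem IsRectifiableSimpleClosed.naturalParameterization_variation
    (hγ : IsRectifiableSimpleClosed γ) {s : ℝ} (hs : s ∈ Icc (0 : ℝ) 1) :
    naturalParameterization γ (Icc 0 1) 0 (variationOnFromTo γ (Icc 0 1) 0 s) = γ s :=
  edist_eq_zero.1 (edist_naturalParameterization_eq_zero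
    hγ.rectifiable.locallyBoundedVariationOn (by simp) hs)

/-- The arc length parametrization has unit speed, in particular Lipschitz constant `1`. -/
theorem IsRectifiableSimpleClosed.isLipschitzLoop (hγ : IsRectifiableSimpleClosed γ) :
    IsLipschitzLoop (naturalParameterization γ (Icc 0 1) 0) 0 (length γ) where
  le := variationOnFromTo.nonneg_of_le _ _ zero_le_one
  lipschitz := by
    have h := has_unit_speed_naturalParameterization γ (s := Icc 0 1) (a := 0)
      hγ.rectifiable.locallyBoundedVariationOn (by simp)
    rw [hγ.image_variation] at h
    have key : ∀ x ∈ Icc 0 (length γ), ∀ y ∈ Icc 0 (length γ), x ≤ y →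
        edist (naturalParameterization γ (Icc 0 1) 0 x) (naturalParameterization γ (Icc 0 1) 0 y) ≤
          edist x y := fun x hx y hy hxy => by
      refine (eVariationOn.edist_le _ (s := Icc 0 (length γ) ∩ Icc x y)
        ⟨hx, le_rfl, hxy⟩ ⟨hy, hxy, le_rfl⟩).trans ?_
      rw [h hx hy, edist_comm, edist_dist, Real.dist_eq, abs_of_nonneg (sub_nonneg.2 hxy)]
      simp
    refine ⟨1, fun x hx y hy => ?_⟩
    rw [ENNReal.coe_one, one_mul]
    rcases le_total x y with hxy | hxy
    · exact key x hx y hy hxy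
    · rw [edist_comm, edist_comm x]
      exact key y hy x hx hxy
  closed := by
    have h0 := hγ.naturalParameterization_variation (s := 0) (by simp)
    have h1 := hγ.naturalParameterization_variation (s := 1) (by simp)
    rw [variationOnFromTo.self] at h0
    rw [h0, length, h1, hγ.closed]

theorem IsRectifiableSimpleClosed.image_naturalParameterization
    (hγ : IsRectifiableSimpleClosed γ) :
    naturalParameterization γ (Icc 0 1) 0 '' Icc 0 (length γ) = trace γ := by
  rw [← hγ.image_variation, image_image, trace]
  exact image_congr fun s hs => hγ.naturalParameterization_variation hs

end

/-! ### Curves that wind once around a region -/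

/-- The loop `c` splits the plane into the open sets `D`, around whose points it winds exactly
once, and `E`, around whose points it does not wind. -/
structure Encloses (c : ℝ → ℂ) (a b : ℝ) (D E : Set ℂ) : Prop extends
    IsLipschitzLoop c a b where
  isOpen_inside : IsOpen D
  isOpen_outside : IsOpen E
  notMem_inside : ∀ z ∈ D, z ∉ c '' Icc a b
  notMem_outside : ∀ z ∈ E, z ∉ c '' Icc a b
  cover : ∀ z, z ∉ c '' Icc a b → z ∈ D ∨ z ∈ E
  winding_inside : ∀ z ∈ D,
    lineIntegral c a b (fun w => (w - z)⁻¹) = 2 * Real.pi * Complex.I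
  winding_outside : ∀ z ∈ E, lineIntegral c a b (fun w => (w - z)⁻¹) = 0

theorem encloses_circle {z₀ : ℂ} {r : ℝ} (hr : 0 < r) :
    Encloses (circleMap z₀ r) 0 (2 * Real.pi) (Metric.ball z₀ r) (Metric.closedBall z₀ r)ᶜ where
  le := Real.two_pi_pos.le
  lipschitz := ⟨_, (lipschitzWith_circleMap z₀ r).lipschitzOnWith⟩
  closed := by simp [circleMap]
  isOpen_inside := Metric.isOpen_ball
  isOpen_outside := Metric.isClosed_closedBall.isOpen_compl
  notMem_inside := by
    rintro z hz ⟨θ, -, rfl⟩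
    exact Metric.sphere_disjoint_ball.le_bot ⟨circleMap_mem_sphere _ hr.le _, hz⟩
  notMem_outside := by
    rintro z hz ⟨θ, -, rfl⟩
    exact hz (circleMap_mem_closedBall _ hr.le _)
  cover := by
    intro z hz
    rcases lt_trichotomy (dist z z₀) r with h | h | h
    · exact Or.inl h
    · refine absurd ?_ hz
      have h1 : z ∈ circleMap z₀ r '' Ioc 0 (2 * Real.pi) := by
        rw [image_circleMap_Ioc, abs_of_pos hr]; exact h
      exact image_mono Ioc_subset_Icc_self h1
    · exact Or.inr (by simpa using h)
  winding_inside := fun z hz => circleIntegral.integral_sub_inv_of_mem_ball hz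
  winding_outside := fun z hz => by
    change (∮ w in C(z₀, r), (w - z)⁻¹) = 0
    refine Complex.circleIntegral_eq_zero_of_differentiable_on_off_countable hr.le
      countable_empty ?_ ?_
    · refine ContinuousOn.inv₀ (by fun_prop) fun w hw h0 => hz ?_
      rwa [← sub_eq_zero.1 h0]
    · intro w hw
      have : w - z ≠ 0 := fun h0 => hz (by
        rw [← sub_eq_zero.1 h0]; exact Metric.ball_subset_closedBall hw.1)
      fun_prop (disch := assumption)

section

variable {γ : ℝ → ℂ}

/-- The points off the curve that it does not enclose. -/
def exterior (γ : ℝ → ℂ) : Set ℂ :=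
  {z | z ∈ (trace γ)ᶜ ∧ ¬ Bornology.IsBounded (connectedComponentIn (trace γ)ᶜ z)}

theorem isOpen_interior (h : IsClosed (trace γ)) : IsOpen (interior γ) := by
  rw [isOpen_iff_mem_nhds]
  rintro z ⟨hz, hb⟩
  filter_upwards [h.isOpen_compl.connectedComponentIn.mem_nhds (mem_connectedComponentIn hz)]
    with w hw
  exact ⟨connectedComponentIn_subset _ _ hw, by rwa [← connectedComponentIn_eq hw]⟩

theorem isOpen_exterior (h : IsClosed (trace γ)) : IsOpen (exterior γ) := by
  rw [isOpen_iff_mem_nhds]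
  rintro z ⟨hz, hb⟩
  filter_upwards [h.isOpen_compl.connectedComponentIn.mem_nhds (mem_connectedComponentIn hz)]
    with w hw
  exact ⟨connectedComponentIn_subset _ _ hw, by rwa [← connectedComponentIn_eq hw]⟩

theorem isPreconnected_compl_closedBall (R : ℝ) :
    IsPreconnected (Metric.closedBall (0 : ℂ) R)ᶜ := by
  -- the image of a convex set of polar coordinates; the condition `0 ≤ r` matters if `R < 0`
  have h : IsPreconnected ((fun p : ℝ × ℝ => (p.1 : ℂ) * Complex.exp (p.2 * Complex.I)) ''
      ((Ioi R ∩ Ici 0) ×ˢ univ)) :=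
    ((ordConnected_Ioi.inter ordConnected_Ici).isPreconnected.prod isPreconnected_univ).image _
      (by fun_prop)
  convert h
  ext z
  simp only [mem_compl_iff, Metric.mem_closedBall, dist_zero_right, not_le, mem_image, mem_prod,
    mem_inter_iff, mem_Ioi, mem_Ici, mem_univ, and_true, Prod.exists]
  constructor
  · exact fun hz => ⟨‖z‖, z.arg, ⟨hz, norm_nonneg z⟩, Complex.norm_mul_exp_arg_mul_I z⟩
  · rintro ⟨r, θ, ⟨hr, hr0⟩, rfl⟩
    rwa [norm_mul, Complex.norm_exp_ofReal_mul_I, mul_one, Complex.norm_of_nonneg hr0]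

theorem tendsto_winding_zero {c : ℝ → ℂ} {a b : ℝ} (h : IsLipschitzLoop c a b) :
    Tendsto (fun z => lineIntegral c a b fun w => (w - z)⁻¹) (cocompact ℂ) (𝓝 0) := by
  obtain ⟨K, hK⟩ := h.lipschitz
  obtain ⟨R, hR⟩ := h.isCompact_image.isBounded.subset_closedBall 0
  have hlim : Tendsto (fun z : ℂ => K * (‖z‖ - R)⁻¹ * |b - a|) (cocompact ℂ) (𝓝 0) := by
    have h1 : Tendsto (fun z : ℂ => (‖z‖ - R)⁻¹) (cocompact ℂ) (𝓝 0) :=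
      tendsto_inv_atTop_zero.comp
        (tendsto_atTop_add_const_right _ (-R) (tendsto_norm_cocompact_atTop (E := ℂ)))
    simpa using (h1.const_mul (K : ℝ)).mul_const |b - a|
  refine squeeze_zero_norm' ?_ hlim
  filter_upwards [(isCompact_closedBall (0 : ℂ) R).compl_mem_cocompact] with z hz
  have hz' : R < ‖z‖ := by simpa using hz
  refine intervalIntegral.norm_integral_le_of_norm_le_const_ae ?_
  filter_upwards [IsLipschitzLoop.ae_mem_Ioo (a := a) (b := b)] with s hs hs'
  have hI := hs hs' h.le
  have hw : ‖c s‖ ≤ R := by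
    simpa using hR (mem_image_of_mem c (Ioo_subset_Icc_self hI))
  have h2 : ‖z‖ - R ≤ ‖c s - z‖ := by
    have := norm_sub_norm_le z (c s)
    rw [norm_sub_rev] at this
    linarith
  rw [norm_smul, norm_inv]
  have h1 := IsLipschitzLoop.norm_deriv_le hK hI
  gcongr

/-- The winding integral has derivative `0`, so it is constant on the unbounded component of `z`; this
component contains a neighbourhood of infinity, where the integral tends to `0`. -/
theorem IsRectifiableSimpleClosed.winding_exterior (hγ : IsRectifiableSimpleClosed γ)
    {z : ℂ} (hz : z ∈ exterior γ) : contourIntegral γ (fun w => (w - z)⁻¹) = 0 := by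
  have hL := hγ.isLipschitzLoop
  have hcpt : IsCompact (trace γ) := hγ.image_naturalParameterization ▸ hL.isCompact_image
  set C := connectedComponentIn (trace γ)ᶜ z with hC
  have hCo : IsOpen C := hcpt.isClosed.isOpen_compl.connectedComponentIn
  have hder : ∀ w ∈ C, HasDerivAt
      (fun z => contourIntegral γ (fun w => (w - z)⁻¹)) 0 w := fun w hw =>
    hL.hasDerivAt_winding (by
      rw [hγ.image_naturalParameterization]; exact connectedComponentIn_subset _ _ hw)
  obtain ⟨k, hk⟩ := hCo.exists_is_const_of_deriv_eq_zero isPreconnected_connectedComponentIn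
    (fun w hw => (hder w hw).differentiableAt.differentiableWithinAt)
    (fun w hw => (hder w hw).deriv)
  obtain ⟨R, hR⟩ := hcpt.isBounded.subset_closedBall 0
  have hsub : (Metric.closedBall (0 : ℂ) R)ᶜ ⊆ C := by
    have : ¬ C ⊆ Metric.closedBall 0 R := fun h => hz.2 (Metric.isBounded_closedBall.subset h)
    obtain ⟨w, hwC, hwR⟩ := not_subset.1 this
    rw [hC, connectedComponentIn_eq hwC]
    exact (isPreconnected_compl_closedBall R).subset_connectedComponentIn hwR
      (compl_subset_compl.2 hR)
  have hk0 : k = 0 := by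
    refine tendsto_nhds_unique (f := fun _ : ℂ => k) (l := cocompact ℂ) tendsto_const_nhds ?_
    refine (tendsto_winding_zero hL).congr' ?_
    filter_upwards [(isCompact_closedBall (0 : ℂ) R).compl_mem_cocompact] with w hw
    exact hk w (hsub hw)
  rw [← hk0]
  exact hk z (mem_connectedComponentIn hz.1)

/-- A positively oriented curve winds once around its interior and not at all around its exterior. -/
theorem IsRectifiableSimpleClosed.encloses (hγ : IsRectifiableSimpleClosed γ)
    (hpos : IsPositivelyOriented γ) :
    Encloses (naturalParameterization γ (Icc 0 1) 0) 0 (length γ) (interior γ) (exterior γ) where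
  toIsLipschitzLoop := hγ.isLipschitzLoop
  isOpen_inside := isOpen_interior
    (hγ.image_naturalParameterization ▸ hγ.isLipschitzLoop.isCompact_image.isClosed)
  isOpen_outside := isOpen_exterior
    (hγ.image_naturalParameterization ▸ hγ.isLipschitzLoop.isCompact_image.isClosed)
  notMem_inside := fun z hz => by rw [hγ.image_naturalParameterization]; exact hz.1
  notMem_outside := fun z hz => by rw [hγ.image_naturalParameterization]; exact hz.1
  cover := fun z hz => by
    rw [hγ.image_naturalParameterization] at hz
    by_cases h : Bornology.IsBounded (connectedComponentIn (trace γ)ᶜ z)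
    · exact Or.inl ⟨hz, h⟩
    · exact Or.inr ⟨hz, h⟩
  winding_inside := fun z hz => hpos z hz
  winding_outside := fun z hz => hγ.winding_exterior hz

end

/-! ### Operators divisible by `B - z` -/

section

variable {X : Type*} [NormedAddCommGroup X] [NormedSpace ℂ X]

/-- `Q` is divisible by `B - z`, holomorphically for `z ∈ U`: there is a holomorphic family `T` on
`U`, commuting with `B`, such that `(B - z) T z = Q`. For a spectral projection `Q` this says that
the part of `B` in the range of `Q` has no spectrum in `U`. -/
def DivisibleOn (B Q : X →L[ℂ] X) (U : Set ℂ) : Prop :=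
  ∃ T : ℂ → X →L[ℂ] X, DifferentiableOn ℂ T U ∧
    ∀ z ∈ U, Commute B (T z) ∧ (B - z • 1) * T z = Q

theorem mem_resolventSet_iff_isUnit {B : X →L[ℂ] X} {z : ℂ} :
    z ∈ resolventSet ℂ B ↔ IsUnit (B - z • (1 : X →L[ℂ] X)) := by
  rw [spectrum.mem_resolventSet_iff, ← IsUnit.neg_iff, neg_sub, Algebra.algebraMap_eq_smul_one]

theorem commute_sub_smul_one {B T : X →L[ℂ] X} (h : Commute B T) (z : ℂ) :
    Commute (B - z • (1 : X →L[ℂ] X)) T :=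
  h.sub_left ((Commute.one_left T).smul_left z)

theorem commute_res {B T : X →L[ℂ] X} (h : Commute B T) (z : ℂ) : Commute T (res B z) := by
  by_cases hu : IsUnit (B - z • (1 : X →L[ℂ] X))
  · obtain ⟨u, hu⟩ := hu
    rw [res, ← hu, Ring.inverse_unit]
    exact Commute.units_inv_right (hu ▸ (commute_sub_smul_one h z).symm)
  · rw [res, Ring.inverse_non_unit _ hu]
    exact Commute.zero_right T

theorem res_eq_neg_resolvent (B : X →L[ℂ] X) (z : ℂ) : res B z = -resolvent B z := by
  rw [resolvent, res, ← neg_sub B, Algebra.algebraMap_eq_smul_one]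
  by_cases hu : IsUnit (B - z • (1 : X →L[ℂ] X))
  · obtain ⟨u, hu⟩ := hu
    rw [← hu, ← Units.val_neg, Ring.inverse_unit, Ring.inverse_unit, inv_neg, Units.val_neg,
      neg_neg]
  · rw [Ring.inverse_non_unit _ hu, Ring.inverse_non_unit _ (by rwa [IsUnit.neg_iff]), neg_zero]

theorem mul_res {B : X →L[ℂ] X} {z : ℂ} (hz : z ∈ resolventSet ℂ B) :
    (B - z • (1 : X →L[ℂ] X)) * res B z = 1 :=
  Ring.mul_inverse_cancel _ (mem_resolventSet_iff_isUnit.1 hz)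

theorem res_mul {B : X →L[ℂ] X} {z : ℂ} (hz : z ∈ resolventSet ℂ B) :
    res B z * (B - z • (1 : X →L[ℂ] X)) = 1 :=
  Ring.inverse_mul_cancel _ (mem_resolventSet_iff_isUnit.1 hz)

theorem differentiableAt_res [CompleteSpace X] {B : X →L[ℂ] X} {z : ℂ}
    (hz : z ∈ resolventSet ℂ B) : DifferentiableAt ℂ (res B) z := by
  obtain ⟨u, hu⟩ := mem_resolventSet_iff_isUnit.1 hz
  have h1 : DifferentiableAt ℂ (fun z : ℂ => B - z • (1 : X →L[ℂ] X)) z := by fun_prop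
  have h2 : DifferentiableAt ℂ Ring.inverse (B - z • (1 : X →L[ℂ] X)) := by
    rw [← hu]; exact differentiableAt_inverse u.isUnit
  exact h2.comp z h1

theorem continuousOn_res [CompleteSpace X] {B : X →L[ℂ] X} {s : Set ℂ}
    (hs : s ⊆ resolventSet ℂ B) : ContinuousOn (res B) s :=
  fun _ hz => (differentiableAt_res (hs hz)).continuousAt.continuousWithinAt

namespace DivisibleOn

variable {B Q Q' : X →L[ℂ] X} {U U' : Set ℂ}

theorem mono (h : DivisibleOn B Q U) (hU : U' ⊆ U) : DivisibleOn B Q U' := by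
  obtain ⟨T, hd, hT⟩ := h
  exact ⟨T, hd.mono hU, fun z hz => hT z (hU hz)⟩

theorem mul_right (h : DivisibleOn B Q U) (hQ' : Commute B Q') : DivisibleOn B (Q * Q') U := by
  obtain ⟨T, hd, hT⟩ := h
  exact ⟨fun z => T z * Q', hd.mul_const Q', fun z hz =>
    ⟨(hT z hz).1.mul_right hQ', by rw [← mul_assoc, (hT z hz).2]⟩⟩

theorem of_resolventSet [CompleteSpace X] (h : Commute B Q) :
    DivisibleOn B Q (resolventSet ℂ B) :=
  ⟨fun z => res B z * Q,
    fun _ hz => ((differentiableAt_res hz).mul_const Q).differentiableWithinAt,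
    fun z hz => ⟨(commute_res (Commute.refl B) z).mul_right h, by
      rw [← mul_assoc, mul_res hz, one_mul]⟩⟩

/-- On the overlap the quotients `T z * Q'` and `Q * T' z` agree, so that they can be glued. -/
theorem mul (h : DivisibleOn B Q U) (h' : DivisibleOn B Q' U') (hU : IsOpen U) (hU' : IsOpen U')
    (hc : Commute B Q) (hc' : Commute B Q') : DivisibleOn B (Q * Q') (U ∪ U') := by
  classical
  obtain ⟨T, hd, hT⟩ := h
  obtain ⟨T', hd', hT'⟩ := h'
  have hov : ∀ z ∈ U, z ∈ U' → T z * Q' = Q * T' z := fun z hz hz' => by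
    rw [← (hT' z hz').2, ← mul_assoc, ← (commute_sub_smul_one (hT z hz).1 z).eq, (hT z hz).2]
  have hg' : ∀ z ∈ U', (if z ∈ U then T z * Q' else Q * T' z) = Q * T' z := fun z hz' => by
    split_ifs with hz
    · exact hov z hz hz'
    · rfl
  refine ⟨fun z => if z ∈ U then T z * Q' else Q * T' z, ?_, ?_⟩
  · rintro z (hz | hz)
    · refine DifferentiableAt.differentiableWithinAt ?_
      refine ((hd.differentiableAt (hU.mem_nhds hz)).mul_const Q').congr_of_eventuallyEq ?_
      filter_upwards [hU.mem_nhds hz] with w hw using if_pos hw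
    · refine DifferentiableAt.differentiableWithinAt ?_
      refine ((hd'.differentiableAt (hU'.mem_nhds hz)).const_mul Q).congr_of_eventuallyEq ?_
      filter_upwards [hU'.mem_nhds hz] with w hw using hg' w hw
  · rintro z (hz | hz)
    · simp only [if_pos hz]
      exact ⟨(hT z hz).1.mul_right hc', by rw [← mul_assoc, (hT z hz).2]⟩
    · simp only [hg' z hz]
      refine ⟨hc.mul_right (hT' z hz).1, ?_⟩
      rw [← mul_assoc, (commute_sub_smul_one hc z).eq, mul_assoc, (hT' z hz).2]

/-- Liouville: only `0` is divisible by `B - z` in the whole plane, since the quotient is an entire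
function that vanishes at infinity. -/
theorem eq_zero [CompleteSpace X] (h : DivisibleOn B Q univ) : Q = 0 := by
  obtain ⟨T, hd, hT⟩ := h
  have hres : ∀ z ∈ resolventSet ℂ B, T z = res B z * Q := fun z hz => by
    rw [← (hT z trivial).2, ← mul_assoc, res_mul hz, one_mul]
  have hlim : Tendsto T (cocompact ℂ) (𝓝 0) := by
    have h1 : Tendsto (fun z => res B z * Q) (cocompact ℂ) (𝓝 0) := by
      have h2 : Tendsto (res B) (cocompact ℂ) (𝓝 0) := by
        have h3 := (spectrum.resolvent_tendsto_cobounded (𝕜 := ℂ) B).neg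
        rw [neg_zero, ← Metric.cobounded_eq_cocompact] at *
        exact h3.congr fun z => (res_eq_neg_resolvent B z).symm
      simpa using h2.mul_const Q
    refine h1.congr' ?_
    filter_upwards [(spectrum.isCompact B).compl_mem_cocompact (X := ℂ)] with z hz
    exact (hres z (not_not.1 hz)).symm
  have h0 : T 0 = 0 :=
    (differentiableOn_univ.1 hd).apply_eq_of_tendsto_cocompact 0 hlim
  rw [← (hT 0 trivial).2, h0, mul_zero]

theorem mul_eq_zero [CompleteSpace X] (h : DivisibleOn B Q U) (h' : DivisibleOn B Q' U')
    (hU : IsOpen U) (hU' : IsOpen U') (hc : Commute B Q) (hc' : Commute B Q')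
    (hs : spectrum ℂ B ⊆ U ∪ U') : Q * Q' = 0 := by
  have h1 := (h.mul h' hU hU' hc hc').mul (of_resolventSet (Commute.one_right B))
    (hU.union hU') (spectrum.isOpen_resolventSet B) (hc.mul_right hc') (Commute.one_right B)
  rw [mul_one] at h1
  exact (h1.mono fun z _ => (em (z ∈ resolventSet ℂ B)).symm.imp_left fun hz => hs hz).eq_zero

/-- An element of the range of `Q` that is annihilated by `B - z` vanishes. -/
theorem apply_eq_zero (h : DivisibleOn B Q U) {z : ℂ} (hz : z ∈ U) {v : X} (hv : B v = z • v) :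
    Q v = 0 := by
  obtain ⟨T, -, hT⟩ := h
  rw [← (hT z hz).2, (commute_sub_smul_one (hT z hz).1 z).eq]
  simp [hv]

end DivisibleOn

/-! ### Riesz projections -/

/-- The Riesz projection `(-1 / 2πi) ∫_c (B - z)⁻¹ dz`. -/
noncomputable def riesz (c : ℝ → ℂ) (a b : ℝ) (B : X →L[ℂ] X) : X →L[ℂ] X :=
  (-1 / (2 * Real.pi * Complex.I) : ℂ) • lineIntegral c a b (res B)

namespace Encloses

variable [CompleteSpace X] {c : ℝ → ℂ} {a b : ℝ} {D E : Set ℂ} {B : X →L[ℂ] X}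

theorem commute_riesz (h : IsLipschitzLoop c a b) (hB : c '' Icc a b ⊆ resolventSet ℂ B)
    {S : X →L[ℂ] X} (hS : Commute B S) : Commute S (riesz c a b B) := by
  refine Commute.smul_right ?_ _
  have hc := continuousOn_res hB
  have h1 := h.lineIntegral_clm (ContinuousLinearMap.mul ℂ (X →L[ℂ] X) S) hc
  have h2 := h.lineIntegral_clm ((ContinuousLinearMap.mul ℂ (X →L[ℂ] X)).flip S) hc
  simp only [ContinuousLinearMap.mul_apply', ContinuousLinearMap.flip_apply] at h1 h2
  rw [Commute, SemiconjBy, ← h1, ← h2]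
  exact h.lineIntegral_congr fun w _ => commute_res hS w

/-- The identity `(B - z) (B - w)⁻¹ (w - z)⁻¹ = (w - z)⁻¹ + (B - w)⁻¹`, integrated over the
loop: up to the winding number of `z`, the operator `riesz` is divisible by `B - z`. -/
theorem divisibleOn_winding_add (h : IsLipschitzLoop c a b) (hB : c '' Icc a b ⊆ resolventSet ℂ B)
    {U : Set ℂ} (hU : IsOpen U) (hUc : ∀ z ∈ U, z ∉ c '' Icc a b) {k : ℂ}
    (hk : ∀ z ∈ U, lineIntegral c a b (fun w => (w - z)⁻¹) = k) :
    DivisibleOn B (k • 1 + lineIntegral c a b (res B)) U := by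
  have hc := continuousOn_res hB
  have hne : ∀ z ∈ U, ∀ w ∈ c '' Icc a b, w - z ≠ 0 := fun z hz w hw h0 =>
    hUc z hz (sub_eq_zero.1 h0 ▸ hw)
  have hinv : ∀ z ∈ U, ContinuousOn (fun w => (w - z)⁻¹) (c '' Icc a b) := fun z hz =>
    ContinuousOn.inv₀ (by fun_prop) (hne z hz)
  have hf : ∀ z ∈ U, ContinuousOn (fun w => (w - z)⁻¹ • res B w) (c '' Icc a b) :=
    fun z hz => (hinv z hz).smul hc
  refine ⟨fun z => lineIntegral c a b fun w => (w - z)⁻¹ • res B w, fun z hz => ?_,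
    fun z hz => ⟨?_, ?_⟩⟩
  · refine (h.hasDerivAt_lineIntegral (f' := fun z w => ((w - z) ^ 2)⁻¹ • res B w) hU hf
      ?_ ?_ hz).differentiableAt.differentiableWithinAt
    · refine ContinuousOn.smul (ContinuousOn.inv₀ (by fun_prop)
        (fun p hp => pow_ne_zero 2 (hne _ hp.1 _ hp.2))) ?_
      exact hc.comp continuousOn_snd fun p hp => hp.2
    · intro z hz w hw
      have := (((hasDerivAt_id z).const_sub w).fun_inv (hne z hz w hw)).smul_const (res B w)
      simpa [div_eq_mul_inv] using this
  · have h1 := h.lineIntegral_clm (ContinuousLinearMap.mul ℂ (X →L[ℂ] X) B) (hf z hz)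
    have h2 := h.lineIntegral_clm ((ContinuousLinearMap.mul ℂ (X →L[ℂ] X)).flip B) (hf z hz)
    simp only [ContinuousLinearMap.mul_apply', ContinuousLinearMap.flip_apply] at h1 h2
    rw [Commute, SemiconjBy, ← h1, ← h2]
    exact h.lineIntegral_congr fun w _ =>
      ((commute_res (Commute.refl B) w).smul_right _).eq
  · have h1 := h.lineIntegral_clm
      (ContinuousLinearMap.mul ℂ (X →L[ℂ] X) (B - z • (1 : X →L[ℂ] X))) (hf z hz)
    simp only [ContinuousLinearMap.mul_apply'] at h1
    have h2 := h.lineIntegral_clm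
      (ContinuousLinearMap.toSpanSingleton ℂ (1 : X →L[ℂ] X)) (hinv z hz)
    simp only [ContinuousLinearMap.toSpanSingleton_apply] at h2
    have h3 := h.lineIntegral_add (f := fun w => (w - z)⁻¹ • (1 : X →L[ℂ] X)) (g := res B)
      ((hinv z hz).smul continuousOn_const) hc
    rw [← h1, ← hk z hz, ← h2, ← h3]
    refine h.lineIntegral_congr fun w hw => ?_
    have e : B - z • (1 : X →L[ℂ] X) = (B - w • (1 : X →L[ℂ] X)) + (w - z) • 1 := by
      rw [sub_smul]; abel
    rw [mul_smul_comm, e, add_mul, mul_res (hB hw), smul_mul_assoc, one_mul, smul_add,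
      smul_smul, inv_mul_cancel₀ (hne z hz w hw), one_smul]

variable (h : Encloses c a b D E) (hB : c '' Icc a b ⊆ resolventSet ℂ B)
include h hB

theorem riesz_divisibleOn : DivisibleOn B (riesz c a b B) E := by
  have := (divisibleOn_winding_add h.toIsLipschitzLoop hB h.isOpen_outside h.notMem_outside
    h.winding_outside).mul_right (Q' := (-1 / (2 * Real.pi * Complex.I) : ℂ) • 1)
    ((Commute.one_right B).smul_right _)
  simpa [riesz] using this

theorem one_sub_riesz_divisibleOn : DivisibleOn B (1 - riesz c a b B) D := by
  have := (divisibleOn_winding_add h.toIsLipschitzLoop hB h.isOpen_inside h.notMem_inside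
    h.winding_inside).mul_right (Q' := (1 / (2 * Real.pi * Complex.I) : ℂ) • 1)
    ((Commute.one_right B).smul_right _)
  convert this using 1
  rw [mul_smul_comm, mul_one, smul_add, smul_smul, one_div,
    inv_mul_cancel₀ Complex.two_pi_I_ne_zero, one_smul, riesz, neg_div, neg_smul, one_div,
    sub_neg_eq_add]

theorem commute_riesz_self : Commute B (riesz c a b B) :=
  commute_riesz h.toIsLipschitzLoop hB (Commute.refl B)

/-- The product `P (1 - P)` is divisible on the exterior, on the interior and on the resolvent set,
hence everywhere. -/
theorem isIdempotentElem_riesz : IsIdempotentElem (riesz c a b B) := by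
  have hc := h.commute_riesz_self hB
  have hc' : Commute B (1 - riesz c a b B) := (Commute.one_right B).sub_right hc
  have h1 := (h.riesz_divisibleOn hB).mul_eq_zero (h.one_sub_riesz_divisibleOn hB)
    h.isOpen_outside h.isOpen_inside hc hc' fun z hz => (h.cover z fun hz' => hz (hB hz')).symm
  rw [mul_sub, mul_one, sub_eq_zero] at h1
  exact h1.symm

end Encloses

end

/-! ### Traces of finite rank operators -/

section

variable {X : Type*} [NormedAddCommGroup X] [NormedSpace ℂ X]

/-- The trace of a finite rank operator may be computed from any factorization through a
finite-dimensional space. -/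
theorem finRankTrace_eq_trace {W : Type*} [AddCommGroup W] [Module ℂ W] [FiniteDimensional ℂ W]
    {T : X →L[ℂ] X} (i : W →ₗ[ℂ] X) (g : X →ₗ[ℂ] W) (h : T.toLinearMap = i ∘ₗ g) :
    finRankTrace T = LinearMap.trace ℂ W (g ∘ₗ i) := by
  have hle : LinearMap.range T.toLinearMap ≤ LinearMap.range i := by
    rw [h]; exact LinearMap.range_comp_le_range g i
  have : FiniteDimensional ℂ (LinearMap.range T.toLinearMap) :=
    Submodule.finiteDimensional_of_le hle
  set j := Submodule.inclusion hle
  have h1 : j ∘ₗ T.toLinearMap.rangeRestrict = i.rangeRestrict ∘ₗ g := by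
    ext x; exact congrArg (fun f : X →ₗ[ℂ] X => f x) h
  have h2 : (LinearMap.range T.toLinearMap).subtype = (LinearMap.range i).subtype ∘ₗ j := by
    ext; rfl
  rw [finRankTrace, h2, ← LinearMap.comp_assoc, LinearMap.trace_comp_comm', ← LinearMap.comp_assoc,
    h1, LinearMap.comp_assoc, LinearMap.trace_comp_comm', LinearMap.comp_assoc]
  rfl

theorem finRankTrace_sum {ι : Type*} (s : Finset ι) (T : ι → X →L[ℂ] X) (N : Submodule ℂ X)
    [FiniteDimensional ℂ N] (hT : ∀ k ∈ s, ∀ x, T k x ∈ N) :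
    finRankTrace (∑ k ∈ s, T k) = ∑ k ∈ s, finRankTrace (T k) := by
  have hS : ∀ x, (∑ k ∈ s, T k) x ∈ N := fun x => by
    rw [_root_.sum_apply]; exact N.sum_mem fun k hk => hT k hk x
  have h1 := finRankTrace_eq_trace N.subtype ((∑ k ∈ s, T k).toLinearMap.codRestrict N hS) rfl
  have h2 : ∀ k : s, finRankTrace (T k) = LinearMap.trace ℂ N
      ((T k).toLinearMap.codRestrict N (hT k k.2) ∘ₗ N.subtype) := fun k =>
    finRankTrace_eq_trace _ _ rfl
  refine h1.trans (Eq.trans ?_ (Finset.sum_coe_sort s fun k => finRankTrace (T k)))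
  rw [Finset.sum_congr rfl fun k _ => h2 k, ← map_sum]
  congr 1
  ext x
  simp only [LinearMap.comp_apply, LinearMap.sum_apply, AddSubmonoidClass.coe_finsetSum,
    LinearMap.codRestrict_apply, ContinuousLinearMap.coe_coe, _root_.sum_apply]
  exact (Finset.sum_coe_sort s fun k => T k (N.subtype x)).symm

theorem finRankTrace_of_isIdempotentElem {P : X →L[ℂ] X} (hP : IsIdempotentElem P)
    [FiniteDimensional ℂ (LinearMap.range P.toLinearMap)] :
    finRankTrace P = Module.finrank ℂ (LinearMap.range P.toLinearMap) := by
  rw [finRankTrace, ← LinearMap.trace_id]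
  congr 1
  ext ⟨_, y, rfl⟩
  exact congrArg (fun f : X →L[ℂ] X => f y) hP

/-- The trace of an endomorphism with no eigenvalue other than `μ`. -/
theorem trace_eq_mul_finrank_of_hasEigenvalue {W : Type*} [AddCommGroup W] [Module ℂ W]
    [FiniteDimensional ℂ W] (f : Module.End ℂ W) (μ : ℂ)
    (h : ∀ z, Module.End.HasEigenvalue f z → z = μ) :
    LinearMap.trace ℂ W f = Module.finrank ℂ W * μ := by
  have hs := IsAlgClosed.splits f.charpoly
  have hr : f.charpoly.roots = Multiset.replicate (Module.finrank ℂ W) μ := by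
    rw [Multiset.eq_replicate]
    refine ⟨by rw [← hs.natDegree_eq_card_roots, LinearMap.charpoly_natDegree], fun z hz => h z ?_⟩
    exact (Module.End.hasEigenvalue_iff_isRoot_charpoly f z).2 (Polynomial.isRoot_of_mem_roots hz)
  rw [Module.End.trace_eq_sum_roots_charpoly_of_splits hs, hr, Multiset.sum_replicate, nsmul_eq_mul]

/-! ### Spectral projections -/

/-- `P` is the spectral projection of `B` for the part of the spectrum in the open set `D`, the
rest of the spectrum being in the open set `E`. -/
structure IsSpectralProj (B P : X →L[ℂ] X) (D E : Set ℂ) : Prop where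
  isOpen_inside : IsOpen D
  isOpen_outside : IsOpen E
  commute : Commute B P
  idem : IsIdempotentElem P
  divisible : DivisibleOn B P E
  divisible_compl : DivisibleOn B (1 - P) D
  spectrum_subset : spectrum ℂ B ⊆ D ∪ E

/-- The endomorphism that `B` induces on the range of a projection `P` commuting with `B`, written
as the compression of `B` to that range. -/
def compression (B P : X →L[ℂ] X) : Module.End ℂ (LinearMap.range P.toLinearMap) :=
  P.toLinearMap.rangeRestrict ∘ₗ B.toLinearMap ∘ₗ (LinearMap.range P.toLinearMap).subtype

theorem apply_of_mem_range {P : X →L[ℂ] X} (hP : IsIdempotentElem P) {x : X}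
    (hx : x ∈ LinearMap.range P.toLinearMap) : P x = x := by
  obtain ⟨y, rfl⟩ := hx
  exact congrArg (fun f : X →L[ℂ] X => f y) hP

theorem coe_compression {B P : X →L[ℂ] X} (hc : Commute B P) (hP : IsIdempotentElem P)
    (x : LinearMap.range P.toLinearMap) : (compression B P x : X) = B x := by
  have h1 := congrArg (fun f : X →L[ℂ] X => f x) hc.eq
  simp only [mul_apply_eq_comp, apply_of_mem_range hP x.2] at h1
  exact h1.symm

theorem finRankTrace_mul_eq_trace_compression {B P : X →L[ℂ] X} (hc : Commute B P)
    [FiniteDimensional ℂ (LinearMap.range P.toLinearMap)] :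
    finRankTrace (B * P) = LinearMap.trace ℂ _ (compression B P) := by
  rw [hc.eq]
  exact finRankTrace_eq_trace (LinearMap.range P.toLinearMap).subtype
    (P.toLinearMap.rangeRestrict ∘ₗ B.toLinearMap) rfl

theorem hasEigenvalue_compression {B P : X →L[ℂ] X} (hc : Commute B P) (hP : IsIdempotentElem P)
    {z : ℂ} (h : Module.End.HasEigenvalue (compression B P) z) :
    ∃ v ≠ 0, P v = v ∧ B v = z • v := by
  obtain ⟨v, hv⟩ := h.exists_hasEigenvector
  refine ⟨v, by simpa using hv.2, apply_of_mem_range hP v.2, ?_⟩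
  rw [← coe_compression hc hP, hv.apply_eq_smul]
  rfl

namespace IsSpectralProj

variable {B P P' : X →L[ℂ] X} {D E D' E' : Set ℂ}

theorem mul_eq_zero [CompleteSpace X] (h : IsSpectralProj B P D E)
    (h' : IsSpectralProj B P' D' E') (hs : spectrum ℂ B ⊆ E ∪ E') : P * P' = 0 :=
  h.divisible.mul_eq_zero h'.divisible h.isOpen_outside h'.isOpen_outside h.commute h'.commute hs

theorem mul_eq_right [CompleteSpace X] (h : IsSpectralProj B P D E)
    (h' : IsSpectralProj B P' D' E') (hs : spectrum ℂ B ⊆ D ∪ E') : P * P' = P' := by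
  have := h.divisible_compl.mul_eq_zero h'.divisible h.isOpen_inside h'.isOpen_outside
    ((Commute.one_right B).sub_right h.commute) h'.commute hs
  rw [sub_mul, one_mul, sub_eq_zero] at this
  exact this.symm

/-- If `z ∈ D` is not an eigenvalue of the part of `B` in the range of `P`, then an inverse of
`B - z` is assembled from the inverses of its parts in the range and in the kernel of `P`. -/
theorem hasEigenvalue (h : IsSpectralProj B P D E)
    [FiniteDimensional ℂ (LinearMap.range P.toLinearMap)] {z : ℂ} (hz : z ∈ spectrum ℂ B)
    (hzD : z ∈ D) : Module.End.HasEigenvalue (compression B P) z := by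
  by_contra hne
  obtain ⟨T', -, hT'⟩ := h.divisible_compl
  obtain ⟨hTB, hT⟩ := hT' z hzD
  generalize T' z = T at hTB hT
  have hu : IsUnit (compression B P - algebraMap ℂ _ z) := by
    by_contra hu
    exact hne (Module.End.hasEigenvalue_iff_mem_spectrum.2
      (by rwa [spectrum.mem_iff, ← IsUnit.neg_iff, neg_sub]))
  obtain ⟨u, hu⟩ := hu
  let N := LinearMap.range P.toLinearMap
  let p : X →L[ℂ] N := P.codRestrict N fun x => ⟨x, rfl⟩
  let S : X →L[ℂ] X := N.subtypeL ∘L (LinearMap.toContinuousLinearMap (u⁻¹).1) ∘L p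
  have hcoe : ∀ x : N, (((B - z • (1 : X →L[ℂ] X)) (x : X)) : X) = (u.1 x : N) := fun x => by
    rw [hu]
    simp [coe_compression h.commute h.idem, Algebra.algebraMap_eq_smul_one]
  have hpB : ∀ x, p ((B - z • (1 : X →L[ℂ] X)) x) = u.1 (p x) := fun x => by
    apply Subtype.ext
    rw [← hcoe]
    exact congrArg (fun f : X →L[ℂ] X => f x) (commute_sub_smul_one h.commute z).eq.symm
  have hS1 : (B - z • (1 : X →L[ℂ] X)) * S = P := by
    ext x
    have h1 : u.1 ((u⁻¹).1 (p x)) = p x :=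
      congrArg (fun f : Module.End ℂ N => f (p x)) u.mul_inv
    exact (hcoe ((u⁻¹).1 (p x))).trans (congrArg Subtype.val h1)
  have hS2 : S * (B - z • (1 : X →L[ℂ] X)) = P := by
    ext x
    have h1 : (u⁻¹).1 (u.1 (p x)) = p x :=
      congrArg (fun f : Module.End ℂ N => f (p x)) u.inv_mul
    have h2 : (u⁻¹).1 (p ((B - z • (1 : X →L[ℂ] X)) x)) = p x := by rw [hpB, h1]
    exact congrArg Subtype.val h2
  refine hz (mem_resolventSet_iff_isUnit.2 ⟨⟨B - z • 1, T + S, ?_, ?_⟩, rfl⟩)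
  · rw [mul_add, hT, hS1, sub_add_cancel]
  · rw [add_mul, ← (commute_sub_smul_one hTB z).eq, hT, hS2, sub_add_cancel]

theorem finite_spectrum_inter (h : IsSpectralProj B P D E)
    [FiniteDimensional ℂ (LinearMap.range P.toLinearMap)] : (spectrum ℂ B ∩ D).Finite :=
  (Module.End.finite_hasEigenvalue (compression B P)).subset
    fun _ hz => h.hasEigenvalue hz.1 hz.2

end IsSpectralProj

theorem Encloses.isSpectralProj [CompleteSpace X] {c : ℝ → ℂ} {a b : ℝ} {D E : Set ℂ}
    {B : X →L[ℂ] X} (h : Encloses c a b D E) (hB : c '' Icc a b ⊆ resolventSet ℂ B) :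
    IsSpectralProj B (riesz c a b B) D E where
  isOpen_inside := h.isOpen_inside
  isOpen_outside := h.isOpen_outside
  commute := h.commute_riesz_self hB
  idem := h.isIdempotentElem_riesz hB
  divisible := h.riesz_divisibleOn hB
  divisible_compl := h.one_sub_riesz_divisibleOn hB
  spectrum_subset := fun z hz => h.cover z fun hz' => hz (hB hz')

/-! ### Discrete eigenvalues -/

/-- The projection at an isolated point `μ` is the Riesz projection of a circle around `μ`, which is
the spectral projection for the disc it bounds. -/
theorem exists_isSpectralProj_spectralProjAt [CompleteSpace X] {B : X →L[ℂ] X} {μ : ℂ}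
    (h : IsIsolatedSpectral B μ) : ∃ D E : Set ℂ, IsSpectralProj B (spectralProjAt B μ) D E ∧
      μ ∈ D ∧ spectrum ℂ B \ {μ} ⊆ E := by
  obtain ⟨hr, hσ⟩ := h.choose_spec
  refine ⟨_, _, ?_, Metric.mem_ball_self hr, fun z hz hz' => hz.2 (hσ.subset ⟨hz.1, hz'⟩)⟩
  rw [spectralProjAt, dif_pos h]
  refine (encloses_circle (z₀ := μ) hr).isSpectralProj ?_
  rintro _ ⟨θ, -, rfl⟩
  by_contra hθ
  have h1 := hσ.subset ⟨hθ, circleMap_mem_closedBall μ hr.le θ⟩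
  exact circleMap_ne_center hr.ne' h1

/-- On the range of the projection at `μ` the only eigenvalue is `μ`. -/
theorem finRankTrace_mul_spectralProjAt [CompleteSpace X] {B : X →L[ℂ] X} {μ : ℂ}
    (h : IsDiscreteEigenvalue B μ) :
    finRankTrace (B * spectralProjAt B μ) = algMult B μ * μ := by
  obtain ⟨D, E, hP, hD, hE⟩ := exists_isSpectralProj_spectralProjAt h.1
  have := h.2
  rw [finRankTrace_mul_eq_trace_compression hP.commute]
  refine trace_eq_mul_finrank_of_hasEigenvalue _ _ fun z hz => ?_
  obtain ⟨v, hv0, hPv, hBv⟩ := hasEigenvalue_compression hP.commute hP.idem hz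
  by_contra hne
  by_cases hzσ : z ∈ spectrum ℂ B
  · exact hv0 (hPv ▸ hP.divisible.apply_eq_zero (hE ⟨hzσ, hne⟩) hBv)
  · exact hv0 ((DivisibleOn.of_resolventSet (Commute.one_right B)).apply_eq_zero
      (not_not.1 hzσ) hBv)

theorem IsDiscreteEigenvalue.hasEigenvalue [CompleteSpace X] {B : X →L[ℂ] X} {μ : ℂ}
    (h : IsDiscreteEigenvalue B μ) : Module.End.HasEigenvalue B.toLinearMap μ := by
  obtain ⟨D, E, hP, hD, hE⟩ := exists_isSpectralProj_spectralProjAt h.1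
  have := h.2
  have hμ : μ ∈ spectrum ℂ B := by
    obtain ⟨r, hr, hσ⟩ := h.1
    exact (hσ.symm.subset rfl).1
  obtain ⟨v, hv0, hPv, hBv⟩ := hasEigenvalue_compression hP.commute hP.idem
    (hP.hasEigenvalue hμ hD)
  exact Module.End.hasEigenvalue_of_hasEigenvector
    ⟨Module.End.mem_eigenspace_iff.2 hBv, hv0⟩

namespace IsSpectralProj

variable [CompleteSpace X] {B P : X →L[ℂ] X} {D E : Set ℂ}

section

variable (h : IsSpectralProj B P D E) [FiniteDimensional ℂ (LinearMap.range P.toLinearMap)]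
include h

omit [CompleteSpace X] in
theorem isIsolatedSpectral {μ : ℂ} (hμ : μ ∈ spectrum ℂ B ∩ D) : IsIsolatedSpectral B μ := by
  have h1 : ((spectrum ℂ B ∩ D) \ {μ}).Finite := h.finite_spectrum_inter.sdiff
  have h2 : D ∩ ((spectrum ℂ B ∩ D) \ {μ})ᶜ ∈ 𝓝 μ :=
    (h.isOpen_inside.inter h1.isClosed.isOpen_compl).mem_nhds ⟨hμ.2, by simp⟩
  obtain ⟨r, hr, hrs⟩ := Metric.nhds_basis_closedBall.mem_iff.1 h2
  refine ⟨r, hr, Subset.antisymm ?_ ?_⟩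
  · intro z hz
    by_contra hne
    exact (hrs hz.2).2 ⟨⟨hz.1, (hrs hz.2).1⟩, hne⟩
  · rintro _ rfl
    exact ⟨hμ.1, Metric.mem_closedBall_self hr.le⟩

theorem mul_spectralProjAt {μ : ℂ} (hμ : μ ∈ spectrum ℂ B ∩ D) :
    P * spectralProjAt B μ = spectralProjAt B μ := by
  obtain ⟨D', E', hP', hD', hE'⟩ :=
    exists_isSpectralProj_spectralProjAt (h.isIsolatedSpectral hμ)
  refine h.mul_eq_right hP' fun z hz => ?_
  by_cases hzμ : z = μ
  · exact Or.inl (hzμ ▸ hμ.2)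
  · exact Or.inr (hE' ⟨hz, hzμ⟩)

theorem isDiscreteEigenvalue {μ : ℂ} (hμ : μ ∈ spectrum ℂ B ∩ D) :
    IsDiscreteEigenvalue B μ := by
  refine ⟨h.isIsolatedSpectral hμ, ?_⟩
  refine Submodule.finiteDimensional_of_le (S₂ := LinearMap.range P.toLinearMap) ?_
  rintro _ ⟨x, rfl⟩
  exact ⟨spectralProjAt B μ x,
    congrArg (fun f : X →L[ℂ] X => f x) (h.mul_spectralProjAt hμ)⟩

/-- A spectral projection of finite rank is the sum of the projections at the points of the spectrum
that belong to it. -/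
theorem eq_sum_spectralProjAt :
    P = ∑ μ ∈ h.finite_spectrum_inter.toFinset, spectralProjAt B μ := by
  -- `1 - ∑ P_μ = ∏ (1 - P_μ)` is divisible by `B - z` near each of the points `μ`
  have key : ∀ s : Finset ℂ, (∀ μ ∈ s, μ ∈ spectrum ℂ B ∩ D) →
      ∃ U : Set ℂ, IsOpen U ∧ ↑s ⊆ U ∧ Commute B (1 - ∑ μ ∈ s, spectralProjAt B μ) ∧
        DivisibleOn B (1 - ∑ μ ∈ s, spectralProjAt B μ) U := by
    intro s
    induction s using Finset.induction_on with
    | empty =>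
      exact fun _ => ⟨∅, isOpen_empty, by simp, by simp, fun _ => 0, by simp, by simp⟩
    | insert μ s hμs ih =>
      intro hs
      obtain ⟨U, hU, hsU, hc, hdiv⟩ := ih fun ν hν => hs ν (Finset.mem_insert_of_mem hν)
      have hμ := hs μ (Finset.mem_insert_self _ _)
      obtain ⟨D', E', hP', hD', hE'⟩ :=
        exists_isSpectralProj_spectralProjAt (h.isIsolatedSpectral hμ)
      have hzero : spectralProjAt B μ * ∑ ν ∈ s, spectralProjAt B ν = 0 := by
        rw [Finset.mul_sum]
        refine Finset.sum_eq_zero fun ν hν => ?_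
        obtain ⟨D'', E'', hP'', hD'', hE''⟩ := exists_isSpectralProj_spectralProjAt
          (h.isIsolatedSpectral (hs ν (Finset.mem_insert_of_mem hν)))
        refine hP'.mul_eq_zero hP'' fun z hz => ?_
        by_cases hzμ : z = μ
        · exact Or.inr (hE'' ⟨hz, fun hzν => hμs (by rwa [← hzμ, mem_singleton_iff.1 hzν])⟩)
        · exact Or.inl (hE' ⟨hz, hzμ⟩)
      have hprod : 1 - ∑ ν ∈ insert μ s, spectralProjAt B ν =
          (1 - spectralProjAt B μ) * (1 - ∑ ν ∈ s, spectralProjAt B ν) := by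
        rw [Finset.sum_insert hμs, sub_mul, one_mul, mul_sub, hzero, mul_one]
        abel
      have hc' := (Commute.one_right B).sub_right hP'.commute
      rw [hprod]
      refine ⟨D' ∪ U, hP'.isOpen_inside.union hU, ?_, hc'.mul_right hc,
        hP'.divisible_compl.mul hdiv hP'.isOpen_inside hU hc' hc⟩
      rw [Finset.coe_insert, insert_subset_iff]
      exact ⟨Or.inl hD', hsU.trans subset_union_right⟩
  obtain ⟨U, hU, hsU, hc, hdiv⟩ := key h.finite_spectrum_inter.toFinset fun μ hμ =>
    h.finite_spectrum_inter.mem_toFinset.1 hμ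
  have h0 := h.divisible.mul_eq_zero hdiv h.isOpen_outside hU h.commute hc fun z hz =>
    (h.spectrum_subset hz).symm.imp_right fun hzD =>
      hsU (h.finite_spectrum_inter.mem_toFinset.2 ⟨hz, hzD⟩)
  rw [mul_sub, mul_one, sub_eq_zero, Finset.mul_sum] at h0
  refine h0.trans (Finset.sum_congr rfl fun μ hμ => ?_)
  exact h.mul_spectralProjAt (h.finite_spectrum_inter.mem_toFinset.1 hμ)

/-- The rank of a projection is its trace, and the trace is additive. -/
theorem sum_algMult : ∑ μ ∈ h.finite_spectrum_inter.toFinset, algMult B μ =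
    Module.finrank ℂ (LinearMap.range P.toLinearMap) := by
  have hr : ∀ μ ∈ h.finite_spectrum_inter.toFinset, ∀ x,
      spectralProjAt B μ x ∈ LinearMap.range P.toLinearMap := fun μ hμ x =>
    ⟨spectralProjAt B μ x, congrArg (fun f : X →L[ℂ] X => f x)
      (h.mul_spectralProjAt (h.finite_spectrum_inter.mem_toFinset.1 hμ))⟩
  have h1 := finRankTrace_sum _ _ _ hr
  rw [← h.eq_sum_spectralProjAt, finRankTrace_of_isIdempotentElem h.idem] at h1
  rw [← Nat.cast_inj (R := ℂ), h1, Nat.cast_sum]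
  refine Finset.sum_congr rfl fun μ hμ => ?_
  have hμ' := h.finite_spectrum_inter.mem_toFinset.1 hμ
  have := (h.isDiscreteEigenvalue hμ').2
  obtain ⟨D', E', hP', -⟩ := exists_isSpectralProj_spectralProjAt (h.isIsolatedSpectral hμ')
  rw [finRankTrace_of_isIdempotentElem hP'.idem, algMult]

theorem finRankTrace_mul : finRankTrace (B * P) =
    ∑ μ ∈ h.finite_spectrum_inter.toFinset, algMult B μ * μ := by
  have hr : ∀ μ ∈ h.finite_spectrum_inter.toFinset, ∀ x,
      (B * spectralProjAt B μ) x ∈ LinearMap.range P.toLinearMap := fun μ hμ x => by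
    refine ⟨B (spectralProjAt B μ x), ?_⟩
    have h1 := h.mul_spectralProjAt (h.finite_spectrum_inter.mem_toFinset.1 hμ)
    have h2 : P * (B * spectralProjAt B μ) = B * spectralProjAt B μ := by
      rw [← mul_assoc, ← h.commute.eq, mul_assoc, h1]
    exact congrArg (fun f : X →L[ℂ] X => f x) h2
  have h1 := finRankTrace_sum _ _ _ hr
  rw [← Finset.mul_sum, ← h.eq_sum_spectralProjAt] at h1
  rw [h1]
  exact Finset.sum_congr rfl fun μ hμ => finRankTrace_mul_spectralProjAt
    (h.isDiscreteEigenvalue (h.finite_spectrum_inter.mem_toFinset.1 hμ))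

omit [CompleteSpace X] in
theorem eigenvaluesIn_eq : eigenvaluesIn B D =
    ∑ μ ∈ h.finite_spectrum_inter.toFinset, Multiset.replicate (algMult B μ) μ :=
  finsum_mem_eq_finite_toFinset_sum _ _

theorem card_eigenvaluesIn : Multiset.card (eigenvaluesIn B D) =
    Module.finrank ℂ (LinearMap.range P.toLinearMap) := by
  simp [h.eigenvaluesIn_eq, ← h.sum_algMult]

theorem sum_eigenvaluesIn : (eigenvaluesIn B D).sum = finRankTrace (B * P) := by
  rw [h.eigenvaluesIn_eq, h.finRankTrace_mul, ← Multiset.coe_sumAddMonoidHom, map_sum]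
  simp

theorem eigMean_eq : eigMean B D = finRankTrace (B * P) /
    (Module.finrank ℂ (LinearMap.range P.toLinearMap) : ℂ) := by
  rw [eigMean, h.card_eigenvaluesIn, h.sum_eigenvaluesIn]

/-- For a spectral projection of rank one the mean is the only eigenvalue. -/
theorem isSimpleEigenvalue_of_finrank_eq_one
    (h1 : Module.finrank ℂ (LinearMap.range P.toLinearMap) = 1) :
    eigMean B D ∈ spectrum ℂ B ∩ D ∧ IsSimpleEigenvalue B (eigMean B D) := by
  have hs := h.sum_algMult
  rw [h1] at hs
  obtain ⟨μ, hμ, hμne⟩ := Finset.exists_ne_zero_of_sum_ne_zero (hs ▸ one_ne_zero)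
  rw [← Finset.add_sum_erase _ _ hμ] at hs
  have hμ1 : algMult B μ = 1 := by omega
  have hμ0 : ∀ ν ∈ h.finite_spectrum_inter.toFinset, ν ≠ μ → algMult B ν = 0 :=
    fun ν hν hne => Finset.sum_eq_zero_iff.1
      (by omega : ∑ ν ∈ h.finite_spectrum_inter.toFinset.erase μ, algMult B ν = 0) ν
      (Finset.mem_erase.2 ⟨hne, hν⟩)
  have hmean : eigMean B D = μ := by
    rw [h.eigMean_eq, h.finRankTrace_mul, h1, Finset.sum_eq_single_of_mem μ hμ, hμ1]
    · simp
    · intro ν hν hne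
      rw [hμ0 ν hν hne]
      simp
  have hμ' := h.finite_spectrum_inter.mem_toFinset.1 hμ
  have hd := h.isDiscreteEigenvalue hμ'
  rw [hmean]
  exact ⟨hμ', hd.hasEigenvalue, hd, hμ1⟩

theorem apply_eq_eigMean_smul
    (h1 : Module.finrank ℂ (LinearMap.range P.toLinearMap) = 1) (v : X) :
    B (P v) = eigMean B D • P v := by
  obtain ⟨k, hk, -⟩ := LinearMap.existsUnique_eq_smul_id_of_finrank_eq_one h1 (compression B P)
  have hmean : eigMean B D = k := by
    rw [h.eigMean_eq, finRankTrace_mul_eq_trace_compression h.commute, hk, map_smul,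
      LinearMap.trace_id, h1]
    simp
  have h2 := coe_compression h.commute h.idem ⟨P v, v, rfl⟩
  rw [hk] at h2
  rw [hmean]
  exact h2.symm

omit [CompleteSpace X] [FiniteDimensional ℂ (LinearMap.range P.toLinearMap)] in
theorem apply_eq_self {z : ℂ} (hz : z ∈ D) {v : X} (hv : B v = z • v) : P v = v := by
  have := h.divisible_compl.apply_eq_zero hz hv
  exact (sub_eq_zero.1 this).symm

end

end IsSpectralProj

end

/-! ### Continuous families of projections -/

section

variable {X : Type*} [NormedAddCommGroup X] [NormedSpace ℂ X]

/-- Kato's intertwining operator: the identity if `P = Q`, and if it is invertible, then it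
conjugates `P` to `Q`. -/
def katoTransform (P Q : X →L[ℂ] X) : X →L[ℂ] X := Q * P + (1 - Q) * (1 - P)

theorem katoTransform_self {P : X →L[ℂ] X} (hP : IsIdempotentElem P) : katoTransform P P = 1 := by
  rw [katoTransform, hP.eq, hP.one_sub.eq, add_sub_cancel]

theorem eq_conj_katoTransform {P Q : X →L[ℂ] X} (hP : IsIdempotentElem P)
    (hQ : IsIdempotentElem Q) {u : (X →L[ℂ] X)ˣ} (hu : u.1 = katoTransform P Q) :
    Q = u.1 * P * (u⁻¹).1 := by
  rw [Units.eq_mul_inv_iff_mul_eq, hu, katoTransform, mul_add, add_mul, ← mul_assoc, ← mul_assoc,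
    hQ.eq, hQ.mul_one_sub_self, zero_mul, mul_assoc, hP.eq, mul_assoc, hP.one_sub_mul_self,
    mul_zero]

theorem rank_conj_le (u : (X →L[ℂ] X)ˣ) (P : X →L[ℂ] X) :
    Module.rank ℂ (LinearMap.range (u.1 * P * (u⁻¹).1).toLinearMap) ≤
      Module.rank ℂ (LinearMap.range P.toLinearMap) :=
  (LinearMap.rank_comp_le_left (u⁻¹).1.toLinearMap (u.1 * P).toLinearMap).trans
    (LinearMap.rank_comp_le_right P.toLinearMap u.1.toLinearMap)

theorem rank_conj (u : (X →L[ℂ] X)ˣ) (P : X →L[ℂ] X) :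
    Module.rank ℂ (LinearMap.range (u.1 * P * (u⁻¹).1).toLinearMap) =
      Module.rank ℂ (LinearMap.range P.toLinearMap) := by
  refine (rank_conj_le u P).antisymm ?_
  have h := rank_conj_le u⁻¹ (u.1 * P * (u⁻¹).1)
  have e : (u⁻¹).1 * (u.1 * P * (u⁻¹).1) * (u⁻¹⁻¹).1 = P := by
    rw [inv_inv, mul_assoc u.1, ← mul_assoc, u.inv_mul, one_mul, mul_assoc, u.inv_mul, mul_one]
  rwa [e] at h

variable [CompleteSpace X] {P : ℂ → X →L[ℂ] X} {U : Set ℂ}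

theorem eventually_isUnit_katoTransform {t₀ : ℂ} (hP : ContinuousAt P t₀)
    (hidem : IsIdempotentElem (P t₀)) : ∀ᶠ t in 𝓝 t₀, IsUnit (katoTransform (P t₀) (P t)) := by
  have h1 : ContinuousAt (fun t => katoTransform (P t₀) (P t)) t₀ := by
    unfold katoTransform; fun_prop
  refine h1.eventually_mem (Units.isOpen.mem_nhds ?_)
  rw [katoTransform_self hidem]
  exact isUnit_one

/-- The rank is locally constant along a continuous family of projections, since `katoTransform` is
invertible near the diagonal. -/
theorem rank_eq_of_continuousOn (hU : IsOpen U) (hUc : IsPreconnected U) (hP : ContinuousOn P U)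
    (hidem : ∀ t ∈ U, IsIdempotentElem (P t)) {s t : ℂ} (hs : s ∈ U) (ht : t ∈ U) :
    Module.rank ℂ (LinearMap.range (P s).toLinearMap) =
      Module.rank ℂ (LinearMap.range (P t).toLinearMap) := by
  refine hUc.induction₂ (fun s t => Module.rank ℂ (LinearMap.range (P s).toLinearMap) =
    Module.rank ℂ (LinearMap.range (P t).toLinearMap)) (fun s hs => ?_)
    (fun _ _ _ _ _ _ h1 h2 => h1.trans h2) (fun _ _ _ _ h => h.symm) hs ht
  filter_upwards [mem_nhdsWithin_of_mem_nhds (eventually_isUnit_katoTransform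
    (hP.continuousAt (hU.mem_nhds hs)) (hidem s hs)), self_mem_nhdsWithin] with t ⟨u, hu⟩ ht
  rw [eq_conj_katoTransform (hidem s hs) (hidem t ht) hu, rank_conj]

/-- Conjugation by the operators `katoTransform (P t₀) (P t)` moves the trace to the fixed range
of `P t₀`, where it is a continuous linear functional. -/
theorem differentiableAt_finRankTrace (hU : IsOpen U) (hP : DifferentiableOn ℂ P U)
    (hidem : ∀ t ∈ U, IsIdempotentElem (P t)) {B : ℂ → X →L[ℂ] X} {t₀ : ℂ} (ht₀ : t₀ ∈ U)
    (hB : DifferentiableAt ℂ B t₀)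
    [FiniteDimensional ℂ (LinearMap.range (P t₀).toLinearMap)] :
    DifferentiableAt ℂ (fun t => finRankTrace (B t * P t)) t₀ := by
  let N := LinearMap.range (P t₀).toLinearMap
  let p : X →L[ℂ] N := (P t₀).codRestrict N fun x => ⟨x, rfl⟩
  let κ : (X →L[ℂ] X) →L[ℂ] (N →L[ℂ] N) := (ContinuousLinearMap.compL ℂ N X N p) ∘L
    ((ContinuousLinearMap.compL ℂ N X X).flip N.subtypeL)
  let τ : (N →L[ℂ] N) →L[ℂ] ℂ := LinearMap.toContinuousLinearMap
    (LinearMap.trace ℂ N ∘ₗ ContinuousLinearMap.coeLM ℂ)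
  have hPt := hP.differentiableAt (hU.mem_nhds ht₀)
  let W : ℂ → X →L[ℂ] X := fun t => katoTransform (P t₀) (P t)
  have hW : DifferentiableAt ℂ W t₀ := by
    simp only [W, katoTransform]; fun_prop
  have hWi : DifferentiableAt ℂ (fun t => Ring.inverse (W t)) t₀ := by
    refine DifferentiableAt.comp t₀ (g := Ring.inverse) (differentiableAt_inverse ?_) hW
    simp only [W]
    rw [katoTransform_self (hidem t₀ ht₀)]
    exact isUnit_one
  have key : DifferentiableAt ℂ (fun t => τ (κ (Ring.inverse (W t) * (B t * W t)))) t₀ :=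
    (τ ∘L κ).differentiableAt.comp t₀ (hWi.mul (hB.mul hW))
  refine key.congr_of_eventuallyEq ?_
  filter_upwards [eventually_isUnit_katoTransform hPt.continuousAt (hidem t₀ ht₀),
    hU.mem_nhds ht₀] with t ⟨u, hu⟩ ht
  have hWt : W t = u.1 := hu.symm
  rw [hWt, Ring.inverse_unit]
  refine finRankTrace_eq_trace ((B t * u.1).toLinearMap ∘ₗ N.subtype)
    (p.toLinearMap ∘ₗ (u⁻¹).1.toLinearMap) ?_
  have h1 : B t * P t = B t * u.1 * (P t₀ * (u⁻¹).1) := by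
    rw [eq_conj_katoTransform (hidem t₀ ht₀) (hidem t ht) hu]
    simp only [mul_assoc]
  rw [h1]
  rfl

end

/-! ### Dependence on the coupling constant -/

section

variable {X : Type*} [NormedAddCommGroup X] [NormedSpace ℂ X]

/-- If each `F n` has derivative `-(n + 1) F (n + 1)`, then the Taylor coefficients of `F 0` are
`(-1)ⁿ F n`. -/
theorem iteratedDeriv_of_hasDerivAt_ladder {E : Type*} [NormedAddCommGroup E] [NormedSpace ℂ E]
    {F : ℕ → ℂ → E} {U : Set ℂ} (hU : IsOpen U)
    (hF : ∀ n, ∀ t ∈ U, HasDerivAt (F n) (-((n : ℂ) + 1) • F (n + 1) t) t) (n : ℕ) :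
    ∀ t ∈ U, iteratedDeriv n (F 0) t = ((-1) ^ n * (n.factorial : ℂ)) • F n t := by
  induction n with
  | zero => intro t _; simp
  | succ n ih =>
    intro t ht
    have h1 : iteratedDeriv n (F 0) =ᶠ[𝓝 t] fun t => ((-1) ^ n * (n.factorial : ℂ)) • F n t := by
      filter_upwards [hU.mem_nhds ht] with s hs using ih s hs
    rw [iteratedDeriv_succ, h1.deriv_eq, ((hF n t ht).fun_const_smul _).deriv, smul_smul,
      Nat.factorial_succ]
    congr 1
    push_cast
    ring

variable [CompleteSpace X] (A V : X →L[ℂ] X)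

theorem continuousAt_res_prod {t z : ℂ} (h : z ∈ resolventSet ℂ (A + t • V)) :
    ContinuousAt (fun p : ℂ × ℂ => res (A + p.1 • V) p.2) (t, z) := by
  obtain ⟨u, hu⟩ := mem_resolventSet_iff_isUnit.1 h
  have h1 : ContinuousAt (fun p : ℂ × ℂ => A + p.1 • V - p.2 • (1 : X →L[ℂ] X)) (t, z) := by
    fun_prop
  refine ContinuousAt.comp (g := Ring.inverse) ?_ h1
  simp only [← hu]
  exact NormedRing.inverse_continuousAt u

theorem hasDerivAt_res {t z : ℂ} (h : z ∈ resolventSet ℂ (A + t • V)) :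
    HasDerivAt (fun t : ℂ => res (A + t • V) z)
      (-(res (A + t • V) z * V * res (A + t • V) z)) t := by
  obtain ⟨u, hu⟩ := mem_resolventSet_iff_isUnit.1 h
  have h1 : HasDerivAt (fun t : ℂ => A + t • V - z • (1 : X →L[ℂ] X)) V t := by
    simpa using (((hasDerivAt_id t).smul_const V).const_add A).sub_const (z • (1 : X →L[ℂ] X))
  have h2 := (hasFDerivAt_ringInverse (𝕜 := ℂ) u)
  rw [hu] at h2
  have h3 := h2.comp_hasDerivAt t h1
  have h4 : res (A + t • V) z = (u⁻¹).1 := by rw [res, ← hu, Ring.inverse_unit]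
  rw [h4]
  refine h3.congr_deriv ?_
  simp

theorem hasDerivAt_res_mul_pow {t z : ℂ} (h : z ∈ resolventSet ℂ (A + t • V)) (n : ℕ) :
    HasDerivAt (fun t : ℂ => res (A + t • V) z * (V * res (A + t • V) z) ^ n)
      (-((n : ℂ) + 1) • (res (A + t • V) z * (V * res (A + t • V) z) ^ (n + 1))) t := by
  induction n with
  | zero => simpa [mul_assoc] using hasDerivAt_res A V h
  | succ n ih =>
    have h1 := ih.mul ((hasDerivAt_res A V h).const_mul V)
    refine (h1.congr_deriv ?_).congr_of_eventuallyEq ?_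
    · have e : res (A + t • V) z * (V * res (A + t • V) z) ^ n *
          (V * -(res (A + t • V) z * V * res (A + t • V) z)) =
          -(res (A + t • V) z * (V * res (A + t • V) z) ^ (n + 1 + 1)) := by
        simp only [pow_succ, mul_neg, mul_assoc]
      rw [e, smul_mul_assoc, mul_assoc, ← pow_succ]
      push_cast
      module
    · filter_upwards with s
      simp only [Pi.mul_apply, pow_succ, mul_assoc]

variable {A V} {c : ℝ → ℂ} {a b : ℝ} {U : Set ℂ}

theorem hasDerivAt_lineIntegral_res (h : IsLipschitzLoop c a b) (hU : IsOpen U)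
    (hA : ∀ t ∈ U, c '' Icc a b ⊆ resolventSet ℂ (A + t • V)) (n : ℕ) {t : ℂ} (ht : t ∈ U) :
    HasDerivAt
      (fun t => lineIntegral c a b fun z => res (A + t • V) z * (V * res (A + t • V) z) ^ n)
      (-((n : ℂ) + 1) •
        lineIntegral c a b fun z => res (A + t • V) z * (V * res (A + t • V) z) ^ (n + 1)) t := by
  have hcont : ∀ n : ℕ, ∀ t ∈ U, ContinuousOn
      (fun z => res (A + t • V) z * (V * res (A + t • V) z) ^ n) (c '' Icc a b) := fun n t ht => by
    have := continuousOn_res (hA t ht)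
    fun_prop
  have h1 := h.hasDerivAt_lineIntegral
    (f' := fun t z => -((n : ℂ) + 1) • (res (A + t • V) z * (V * res (A + t • V) z) ^ (n + 1)))
    hU (hcont n) ?_ (fun t ht z hz => hasDerivAt_res_mul_pow A V (hA t ht hz) n) ht
  · have h2 := h.lineIntegral_clm (-((n : ℂ) + 1) • ContinuousLinearMap.id ℂ (X →L[ℂ] X))
      (hcont (n + 1) t ht)
    simp only [_root_.smul_apply, ContinuousLinearMap.id_apply] at h2
    rwa [← h2]
  · have h3 : ContinuousOn (fun p : ℂ × ℂ => res (A + p.1 • V) p.2) (U ×ˢ (c '' Icc a b)) :=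
      fun p hp => (continuousAt_res_prod A V (hA p.1 hp.1 hp.2)).continuousWithinAt
    fun_prop

theorem differentiableOn_riesz (h : IsLipschitzLoop c a b) (hU : IsOpen U)
    (hA : ∀ t ∈ U, c '' Icc a b ⊆ resolventSet ℂ (A + t • V)) :
    DifferentiableOn ℂ (fun t => riesz c a b (A + t • V)) U := fun t ht => by
  have h1 := (hasDerivAt_lineIntegral_res h hU hA 0 ht).differentiableAt
  simp only [pow_zero, mul_one] at h1
  exact (h1.const_smul (-1 / (2 * Real.pi * Complex.I) : ℂ)).differentiableWithinAt

theorem iteratedDeriv_lineIntegral_res (h : IsLipschitzLoop c a b) (hU : IsOpen U)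
    (hA : ∀ t ∈ U, c '' Icc a b ⊆ resolventSet ℂ (A + t • V)) (n : ℕ) {t : ℂ} (ht : t ∈ U) :
    iteratedDeriv n (fun t => lineIntegral c a b (res (A + t • V))) t =
      ((-1) ^ n * (n.factorial : ℂ)) •
        lineIntegral c a b fun z => res (A + t • V) z * (V * res (A + t • V) z) ^ n := by
  rw [← iteratedDeriv_of_hasDerivAt_ladder (F := fun n t =>
    lineIntegral c a b fun z => res (A + t • V) z * (V * res (A + t • V) z) ^ n) hU
    (fun n t ht => hasDerivAt_lineIntegral_res h hU hA n ht) n t ht]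
  simp only [pow_zero, mul_one]

end

/-! ### The disc of convergence -/

section

variable {X : Type*} [NormedAddCommGroup X] [NormedSpace ℂ X] [CompleteSpace X]
  {A V : X →L[ℂ] X} {γ : ℝ → ℂ}

omit [CompleteSpace X] in
theorem isUnit_one_add_smul {W : X →L[ℂ] X} {t : ℂ} (h : ‖t‖ₑ * spectralRadius ℂ W < 1) :
    IsUnit (1 + t • W) := by
  rcases eq_or_ne t 0 with rfl | ht
  · simp
  have h1 : (‖-t‖₊ : ENNReal) < (spectralRadius ℂ W)⁻¹ := by
    rw [nnnorm_neg, ← one_div, ENNReal.lt_div_iff_mul_lt (Or.inr ENNReal.coe_ne_top)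
      (Or.inr (by simpa using ht))]
    exact h
  have h2 := spectrum.isUnit_one_sub_smul_of_lt_inv_radius h1
  rwa [neg_smul, sub_neg_eq_add] at h2

omit [CompleteSpace X] in
theorem trace_subset_resolventSet (hA : trace γ ⊆ resolventSet ℂ A) {t : ℂ}
    (ht : t ∈ pertDisc γ A V) : trace γ ⊆ resolventSet ℂ (A + t • V) := by
  intro z hz
  have h1 : IsUnit (1 + t • (V * res A z)) := by
    refine isUnit_one_add_smul (lt_of_le_of_lt ?_ ht)
    gcongr
    exact le_iSup₂_of_le z hz le_rfl
  rw [mem_resolventSet_iff_isUnit]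
  convert h1.mul (mem_resolventSet_iff_isUnit.1 (hA hz)) using 1
  rw [add_mul, one_mul, smul_mul_assoc, mul_assoc, res_mul (hA hz), mul_one]
  abel

/-- The supremum of the spectral radii is finite by compactness of the curve; if it is `0`, the disc is
the whole plane. -/
theorem pertDisc_eq_eball (hc : IsCompact (trace γ)) (hA : trace γ ⊆ resolventSet ℂ A) :
    pertDisc γ A V =
      Metric.eball 0 (⨆ z ∈ trace γ, spectralRadius ℂ (V * res A z))⁻¹ := by
  obtain ⟨M, hM⟩ := hc.exists_bound_of_continuousOn (f := fun z => V * res A z)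
    (continuousOn_const.mul (continuousOn_res hA))
  have hfin : (⨆ z ∈ trace γ, spectralRadius ℂ (V * res A z)) ≠ ⊤ := by
    refine ne_top_of_le_ne_top (ENNReal.ofReal_ne_top (r := M)) (iSup₂_le fun z hz => ?_)
    refine iSup₂_le fun k hk => ?_
    have h1 := spectrum.norm_le_norm_mul_of_mem hk
    have h2 : ‖V * res A z‖ * ‖(1 : X →L[ℂ] X)‖ ≤ M * 1 :=
      mul_le_mul (hM z hz) ContinuousLinearMap.norm_id_le (norm_nonneg _)
        ((norm_nonneg _).trans (hM z hz))
    rw [← enorm_eq_nnnorm, ← ofReal_norm]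
    exact ENNReal.ofReal_le_ofReal (by linarith)
  ext t
  rw [pertDisc, mem_ofPred_eq, Metric.mem_eball, edist_zero_right]
  rw [← one_div, ENNReal.lt_div_iff_mul_lt (Or.inr enorm_ne_top) (Or.inl hfin)]

omit [CompleteSpace X] in
theorem zero_mem_pertDisc : (0 : ℂ) ∈ pertDisc γ A V := by simp [pertDisc]

end

/-! ### The perturbed spectral projection -/

section

variable {X : Type*} [NormedAddCommGroup X] [NormedSpace ℂ X] [CompleteSpace X]
  {A V : X →L[ℂ] X} {γ : ℝ → ℂ}

theorem IsRectifiableSimpleClosed.isSpectralProj_proj (hγ : IsRectifiableSimpleClosed γ)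
    (hpos : IsPositivelyOriented γ) (hA : trace γ ⊆ resolventSet ℂ A) :
    IsSpectralProj A (proj γ A) (interior γ) (exterior γ) :=
  (hγ.encloses hpos).isSpectralProj (hγ.image_naturalParameterization ▸ hA)

theorem IsRectifiableSimpleClosed.isCompact_trace (hγ : IsRectifiableSimpleClosed γ) :
    IsCompact (trace γ) :=
  hγ.image_naturalParameterization ▸ hγ.isLipschitzLoop.isCompact_image

theorem IsRectifiableSimpleClosed.isOpen_pertDisc (hγ : IsRectifiableSimpleClosed γ)
    (hA : trace γ ⊆ resolventSet ℂ A) : IsOpen (pertDisc γ A V) := by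
  rw [pertDisc_eq_eball hγ.isCompact_trace hA]
  exact Metric.isOpen_eball

/-- A holomorphic function on the disc is the sum of its Taylor series in the whole disc. -/
theorem IsRectifiableSimpleClosed.hasSum_taylorSeries {E : Type*} [NormedAddCommGroup E]
    [NormedSpace ℂ E] [CompleteSpace E] (hγ : IsRectifiableSimpleClosed γ)
    (hA : trace γ ⊆ resolventSet ℂ A) {f : ℂ → E}
    (hf : DifferentiableOn ℂ f (pertDisc γ A V)) {t : ℂ} (ht : t ∈ pertDisc γ A V) :
    HasSum (fun n : ℕ => t ^ (n + 1) •
      (((n + 1).factorial : ℂ)⁻¹ • iteratedDeriv (n + 1) f 0)) (f t - f 0) := by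
  rw [pertDisc_eq_eball hγ.isCompact_trace hA] at hf ht
  have h1 := (hasSum_nat_add_iff' 1).2 (Complex.hasSum_taylorSeries_on_eball hf ht)
  simpa [smul_comm (t ^ _)] using h1

theorem IsRectifiableSimpleClosed.differentiableOn_proj (hγ : IsRectifiableSimpleClosed γ)
    (hA : trace γ ⊆ resolventSet ℂ A) :
    DifferentiableOn ℂ (fun t : ℂ => proj γ (A + t • V)) (pertDisc γ A V) :=
  differentiableOn_riesz hγ.isLipschitzLoop (hγ.isOpen_pertDisc hA) fun t ht => by
    rw [hγ.image_naturalParameterization]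
    exact trace_subset_resolventSet hA ht

theorem IsRectifiableSimpleClosed.iteratedDeriv_proj (hγ : IsRectifiableSimpleClosed γ)
    (hA : trace γ ⊆ resolventSet ℂ A) (n : ℕ) :
    (n.factorial : ℂ)⁻¹ • iteratedDeriv n (fun t : ℂ => proj γ (A + t • V)) 0 =
      projCoeff γ A V n := by
  have h1 : iteratedDeriv n (fun t : ℂ => contourIntegral γ (res (A + t • V))) 0 =
      ((-1) ^ n * (n.factorial : ℂ)) • contourIntegral γ
        fun z => res (A + (0 : ℂ) • V) z * (V * res (A + (0 : ℂ) • V) z) ^ n :=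
    iteratedDeriv_lineIntegral_res hγ.isLipschitzLoop (hγ.isOpen_pertDisc hA)
      (fun t ht => by
        rw [hγ.image_naturalParameterization]
        exact trace_subset_resolventSet hA ht) n (zero_mem_pertDisc (A := A) (V := V))
  have h2 : iteratedDeriv n (fun t : ℂ => proj γ (A + t • V)) 0 =
      (-1 / (2 * Real.pi * Complex.I) : ℂ) •
        iteratedDeriv n (fun t : ℂ => contourIntegral γ (res (A + t • V))) 0 :=
    iteratedDeriv_const_smul_field (-1 / (2 * Real.pi * Complex.I) : ℂ)
      (fun t : ℂ => contourIntegral γ (res (A + t • V)))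
  rw [h2, h1]
  simp only [zero_smul, add_zero, smul_smul, projCoeff]
  congr 1
  have : (n.factorial : ℂ) ≠ 0 := Nat.cast_ne_zero.2 n.factorial_ne_zero
  field_simp
  ring

theorem IsRectifiableSimpleClosed.hasSum_proj (hγ : IsRectifiableSimpleClosed γ)
    (hA : trace γ ⊆ resolventSet ℂ A) {t : ℂ} (ht : t ∈ pertDisc γ A V) :
    HasSum (fun n : ℕ => t ^ (n + 1) • projCoeff γ A V (n + 1))
      (proj γ (A + t • V) - proj γ A) := by
  have h1 := hγ.hasSum_taylorSeries hA (hγ.differentiableOn_proj hA) ht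
  simpa only [hγ.iteratedDeriv_proj hA, zero_smul, add_zero] using h1

theorem IsRectifiableSimpleClosed.rank_proj (hγ : IsRectifiableSimpleClosed γ)
    (hpos : IsPositivelyOriented γ) (hA : trace γ ⊆ resolventSet ℂ A) {t : ℂ}
    (ht : t ∈ pertDisc γ A V) :
    Module.rank ℂ (LinearMap.range (proj γ (A + t • V)).toLinearMap) =
      Module.rank ℂ (LinearMap.range (proj γ A).toLinearMap) := by
  have h1 := rank_eq_of_continuousOn (hγ.isOpen_pertDisc hA)
    (by rw [pertDisc_eq_eball hγ.isCompact_trace hA]; exact Metric.isPreconnected_eball)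
    (hγ.differentiableOn_proj hA).continuousOn
    (fun t ht => (hγ.isSpectralProj_proj hpos (trace_subset_resolventSet hA ht)).idem)
    ht zero_mem_pertDisc
  rwa [zero_smul, add_zero] at h1

end

end SpectralPerturbation

theorem mainTheorem11 {X : Type*} [NormedAddCommGroup X] [NormedSpace ℂ X] [CompleteSpace X]
    (A V : X →L[ℂ] X) (γ : ℝ → ℂ)
    (hγ : SpectralPerturbation.IsRectifiableSimpleClosed γ)
    (hγ_pos : SpectralPerturbation.IsPositivelyOriented γ)
    (hA : SpectralPerturbation.trace γ ⊆ resolventSet ℂ A)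
    (hd : ∀ μ ∈ spectrum ℂ A ∩ SpectralPerturbation.interior γ,
      SpectralPerturbation.IsDiscreteEigenvalue A μ)
    (m : ℕ) (hm : 0 < m)
    (hrank : Module.rank ℂ
      (LinearMap.range (SpectralPerturbation.proj γ A).toLinearMap) = (m : Cardinal)) :
    -- for each `t` in the disc: the curve stays in the resolvent set of `A + tV`, the spectrum of
    -- `A + tV` inside it consists of exactly `m` discrete eigenvalues, the mean is a trace
    (∀ t ∈ SpectralPerturbation.pertDisc γ A V,
      SpectralPerturbation.trace γ ⊆ resolventSet ℂ (A + t • V) ∧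
      (spectrum ℂ (A + t • V) ∩ SpectralPerturbation.interior γ).Finite ∧
      (∀ μ ∈ spectrum ℂ (A + t • V) ∩ SpectralPerturbation.interior γ,
        SpectralPerturbation.IsDiscreteEigenvalue (A + t • V) μ) ∧
      Multiset.card (SpectralPerturbation.eigenvaluesIn (A + t • V)
        (SpectralPerturbation.interior γ)) = m ∧
      Module.rank ℂ (LinearMap.range
        (SpectralPerturbation.proj γ (A + t • V)).toLinearMap) = (m : Cardinal) ∧
      SpectralPerturbation.eigMean (A + t • V) (SpectralPerturbation.interior γ) =
        SpectralPerturbation.finRankTrace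
          ((A + t • V) * SpectralPerturbation.proj γ (A + t • V)) / (m : ℂ) ∧
      HasSum (fun n : ℕ => t ^ (n + 1) • SpectralPerturbation.projCoeff γ A V (n + 1))
        (SpectralPerturbation.proj γ (A + t • V) - SpectralPerturbation.proj γ A) ∧
      SpectralPerturbation.eigMean (A + t • V) (SpectralPerturbation.interior γ) =
        SpectralPerturbation.finRankTrace ((A + t • V) * (SpectralPerturbation.proj γ A +
          ∑' n : ℕ, t ^ (n + 1) • SpectralPerturbation.projCoeff γ A V (n + 1))) / (m : ℂ)) ∧
    -- the mean is analytic in the disc, with a power series that converges in the whole disc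
    AnalyticOnNhd ℂ
      (fun t : ℂ => SpectralPerturbation.eigMean (A + t • V) (SpectralPerturbation.interior γ))
      (SpectralPerturbation.pertDisc γ A V) ∧
    (∃ α : ℕ → ℂ, ∀ t ∈ SpectralPerturbation.pertDisc γ A V,
      HasSum (fun n : ℕ => α (n + 1) * t ^ (n + 1))
        (SpectralPerturbation.eigMean (A + t • V) (SpectralPerturbation.interior γ) -
          SpectralPerturbation.eigMean A (SpectralPerturbation.interior γ))) ∧
    -- the case of a simple eigenvalue
    (m = 1 →
      SpectralPerturbation.eigMean (A + (0 : ℂ) • V) (SpectralPerturbation.interior γ) =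
        SpectralPerturbation.eigMean A (SpectralPerturbation.interior γ) ∧
      (∀ t ∈ SpectralPerturbation.pertDisc γ A V,
        SpectralPerturbation.IsSimpleEigenvalue (A + t • V)
          (SpectralPerturbation.eigMean (A + t • V) (SpectralPerturbation.interior γ))) ∧
      ∀ v : X, A v = SpectralPerturbation.eigMean A (SpectralPerturbation.interior γ) • v →
        (∀ t ∈ SpectralPerturbation.pertDisc γ A V,
          (A + t • V) (SpectralPerturbation.proj γ (A + t • V) v) =
            SpectralPerturbation.eigMean (A + t • V) (SpectralPerturbation.interior γ) •
              SpectralPerturbation.proj γ (A + t • V) v) ∧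
        AnalyticOnNhd ℂ (fun t : ℂ => SpectralPerturbation.proj γ (A + t • V) v)
          (SpectralPerturbation.pertDisc γ A V) ∧
        ∃ w : ℕ → X, ∀ t ∈ SpectralPerturbation.pertDisc γ A V,
          HasSum (fun n : ℕ => t ^ (n + 1) • w (n + 1))
            (SpectralPerturbation.proj γ (A + t • V) v - v)) := by
  have hspec : ∀ t ∈ SpectralPerturbation.pertDisc γ A V,
      SpectralPerturbation.IsSpectralProj (A + t • V) (SpectralPerturbation.proj γ (A + t • V))
        (SpectralPerturbation.interior γ) (SpectralPerturbation.exterior γ) := fun t ht =>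
    hγ.isSpectralProj_proj hγ_pos (SpectralPerturbation.trace_subset_resolventSet hA ht)
  have hrank' : ∀ t ∈ SpectralPerturbation.pertDisc γ A V, Module.rank ℂ (LinearMap.range
      (SpectralPerturbation.proj γ (A + t • V)).toLinearMap) = (m : Cardinal) := fun t ht =>
    (hγ.rank_proj hγ_pos hA ht).trans hrank
  have hfd : ∀ t ∈ SpectralPerturbation.pertDisc γ A V, FiniteDimensional ℂ (LinearMap.range
      (SpectralPerturbation.proj γ (A + t • V)).toLinearMap) := fun t ht =>
    Module.finite_of_rank_eq_nat (hrank' t ht)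
  have hfinrank : ∀ t ∈ SpectralPerturbation.pertDisc γ A V, Module.finrank ℂ (LinearMap.range
      (SpectralPerturbation.proj γ (A + t • V)).toLinearMap) = m := fun t ht =>
    Module.finrank_eq_of_rank_eq (hrank' t ht)
  have hmean : ∀ t ∈ SpectralPerturbation.pertDisc γ A V,
      SpectralPerturbation.eigMean (A + t • V) (SpectralPerturbation.interior γ) =
        SpectralPerturbation.finRankTrace
          ((A + t • V) * SpectralPerturbation.proj γ (A + t • V)) / (m : ℂ) := fun t ht => by
    have := hfd t ht
    rw [(hspec t ht).eigMean_eq, hfinrank t ht]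
  have hopen := hγ.isOpen_pertDisc (V := V) hA
  have hmd : DifferentiableOn ℂ (fun t : ℂ => SpectralPerturbation.eigMean (A + t • V)
      (SpectralPerturbation.interior γ)) (SpectralPerturbation.pertDisc γ A V) := fun t ht => by
    have := hfd t ht
    refine DifferentiableWithinAt.congr ?_ hmean (hmean t ht)
    exact ((SpectralPerturbation.differentiableAt_finRankTrace hopen
      (hγ.differentiableOn_proj hA) (fun s hs => (hspec s hs).idem) ht
      (B := fun t => A + t • V) (by fun_prop)).div_const _).differentiableWithinAt
  refine ⟨fun t ht => ?_, hmd.analyticOnNhd hopen, ?_, fun hm1 => ⟨?_, fun t ht => ?_, ?_⟩⟩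
  · have := hfd t ht
    have hsum := hγ.hasSum_proj hA ht
    refine ⟨SpectralPerturbation.trace_subset_resolventSet hA ht,
      (hspec t ht).finite_spectrum_inter, fun μ hμ => (hspec t ht).isDiscreteEigenvalue hμ,
      ?_, hrank' t ht, hmean t ht, hsum, ?_⟩
    · rw [(hspec t ht).card_eigenvaluesIn, hfinrank t ht]
    · rw [hsum.tsum_eq, add_sub_cancel]
      exact hmean t ht
  · refine ⟨fun n => (n.factorial : ℂ)⁻¹ • iteratedDeriv n (fun t : ℂ =>
      SpectralPerturbation.eigMean (A + t • V) (SpectralPerturbation.interior γ)) 0,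
      fun t ht => ?_⟩
    have h1 := hγ.hasSum_taylorSeries hA hmd ht
    simp only [zero_smul, add_zero, smul_eq_mul, mul_comm (t ^ _)] at h1
    simpa only [smul_eq_mul] using h1
  · rw [zero_smul, add_zero]
  · have := hfd t ht
    exact ((hspec t ht).isSimpleEigenvalue_of_finrank_eq_one
      ((hfinrank t ht).trans hm1)).2
  · intro v hv
    have h0 := SpectralPerturbation.zero_mem_pertDisc (γ := γ) (A := A) (V := V)
    have hPv : SpectralPerturbation.proj γ A v = v := by
      have h1 := hspec 0 h0
      have := hfd 0 h0
      have h2 := (h1.isSimpleEigenvalue_of_finrank_eq_one ((hfinrank 0 h0).trans hm1)).1.2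
      rw [zero_smul, add_zero] at h1 h2
      exact h1.apply_eq_self h2 hv
    refine ⟨fun t ht => ?_, ?_, fun n => SpectralPerturbation.projCoeff γ A V n v, fun t ht => ?_⟩
    · have := hfd t ht
      exact (hspec t ht).apply_eq_eigMean_smul ((hfinrank t ht).trans hm1) v
    · exact DifferentiableOn.analyticOnNhd
        ((hγ.differentiableOn_proj hA).clm_apply (differentiableOn_const v)) hopen
    · have h1 := (hγ.hasSum_proj hA ht).mapL (ContinuousLinearMap.apply ℂ X v)
      simpa [hPv] using h1
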